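/- **Theorem (maximum capacity of restricted geometric mobile sensor networks).** *Definitions.* A combinatorial mobile sensor network (CMSN) of $n$ sensors $1,\dots,n$ is a finite sequence $a_1,\dots,a_L$ of two-element subsets of $\{1,\dots,n\}$ (called packets; repetitions allowed). The packet $a_k$ can reach the sensor $x$ if there are $m\ge 1$ and indices $k=k_1<k_2<\cdots<k_m\le L$ with $a_{k_{j-1}}\cap a_{k_j}\neq\emptyset$ for $2\le j\le m$ and $x\in a_{k_m}$. The capacity of the CMSN is $$\frac{1}{nL}\sum_{k=1}^{L}\#\{1\le x\le n : a_k \text{ can reach } x\}$$ (taken to be $0$ if $nL=0$). A restricted geometric mobile sensor network (RGMSN) of $n$ sensors and $s$ slopes is a CMSN of $n$ sensors for which there are $n$ distinct lines in the Euclidean plane, none of them vertical, with at most $s$ distinct slopes in total, such that no two intersections (of different pairs of lines) have the same $x$-coordinate, and the CMSN is the list of all pairs $\{i,j\}$ such that line $i$ and line $j$ intersect, sorted by the $x$-coordinate of the intersection in ascending order. *Statement.* Fix an integer $s\ge 3$. For every $n\ge 2$ the capacities of RGMSNs of $n$ sensors and $s$ slopes have a maximum $M_s(n)$, and as $n\to\infty$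 $$M_s(n)=\begin{cases}1-\dfrac{s-2}{s-3}\,n^{-1}+\Theta(n^{-2}) & \text{if } s\ge 4,\\[2mm] 1-n^{-1/2}+\dfrac98\,n^{-1}+\Theta(n^{-3/2}) & \text{if } s=3.\end{cases}$$ Here $\Theta(g(n))$ denotes a quantity lying between $c_1g(n)$ and $c_2g(n)$ for all sufficiently large $n$, where $c_1,c_2>0$ are constants that may depend on $s$. -/

import Mathlib

/-- A combinatorial mobile sensor network of `n` sensors (numbered by `Fin n`): a finite sequence
of packets, each packet being a two-element set of sensors; repetitions are allowed. -/
structure CMSN (n : ℕ) where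
  /-- the length of the sequence -/
  len : ℕ
  /-- the sequence of packets -/
  packet : Fin len → Finset (Fin n)
  card_packet : ∀ k, (packet k).card = 2

namespace CMSN

variable {n : ℕ} (C : CMSN n)

/-- One hop: from a packet to a strictly later packet that shares a sensor with it. -/
def Hop (k l : Fin C.len) : Prop :=
  k < l ∧ (C.packet k ∩ C.packet l).Nonempty

/-- The packet with index `k` can reach the sensor `x`: there is a chain of zero or more hops
`k = k₁ < k₂ < ⋯ < kₘ`, consecutive packets intersecting, with `x` in the last packet. -/
def CanReach (k : Fin C.len) (x : Fin n) : Prop :=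
  ∃ l, Relation.ReflTransGen C.Hop k l ∧ x ∈ C.packet l

open Classical in
/-- The capacity: the number of deliveries divided by `n` times the length of the sequence. -/
noncomputable def capacity : ℝ :=
  1 / ((n : ℝ) * (C.len : ℝ)) *
    ∑ k : Fin C.len, ((Finset.univ.filter fun x : Fin n => C.CanReach k x).card : ℝ)

end CMSN

/-- `n` distinct non-vertical lines `y = slope i * x + intercept i` in the plane. -/
structure LineArrangement (n : ℕ) where
  slope : Fin n → ℝ
  intercept : Fin n → ℝ
  distinct : Function.Injective fun i => (slope i, intercept i)

namespace LineArrangement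

variable {n : ℕ} (A : LineArrangement n)

/-- The different lines `i` and `j` intersect in a point with first coordinate `x`. -/
def MeetAt (i j : Fin n) (x : ℝ) : Prop :=
  i ≠ j ∧ A.slope i * x + A.intercept i = A.slope j * x + A.intercept j

/-- No two intersections (of different pairs of lines) have the same first coordinate. -/
def Generic : Prop :=
  ∀ (i j k l : Fin n) (x : ℝ), A.MeetAt i j x → A.MeetAt k l x →
    ({i, j} : Finset (Fin n)) = {k, l}

/-- The number of distinct slopes. -/
noncomputable def numSlopes : ℕ := (Set.range A.slope).ncard

/-- The network `C` is the list of all pairs `{i, j}` such that the lines `i` and `j` intersect,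
sorted by the first coordinates of the intersections in ascending order. -/
def Generates (C : CMSN n) : Prop :=
  Set.range C.packet = {p | ∃ i j x, A.MeetAt i j x ∧ p = {i, j}} ∧
  ∀ (k l : Fin C.len) (i j i' j' : Fin n) (x x' : ℝ), k < l →
    C.packet k = {i, j} → A.MeetAt i j x →
    C.packet l = {i', j'} → A.MeetAt i' j' x' → x < x'

end LineArrangement

/-- `C` is a restricted geometric mobile sensor network with (at most) `s` slopes. -/
def IsRGMSN {n : ℕ} (s : ℕ) (C : CMSN n) : Prop :=
  ∃ A : LineArrangement n, A.numSlopes ≤ s ∧ A.Generic ∧ A.Generates C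

/-- The set of capacities of all restricted geometric mobile sensor networks of `n` sensors and
`s` slopes. -/
def rgmsnCapacities (n s : ℕ) : Set ℝ :=
  {c | ∃ C : CMSN n, IsRGMSN s C ∧ c = C.capacity}

/-- The maximum of `rgmsnCapacities n s`. -/
noncomputable def rgmsnMaxCapacity (n s : ℕ) : ℝ := sSup (rgmsnCapacities n s)

/-!
Write `lost C` for the number of pairs (packet, sensor) such that the packet cannot reach the
sensor, so that the capacity is `1 - lost C / (n L)`, where `L` is the number of packets. The
capacities form a finite nonempty set, hence have a maximum; the asymptotics come from a lower
bound on `lost` and a matching construction.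

*Lower bound* (`LineArrangement.Generates.exists_bounds`). Let `c` lines have the greatest slope
and `a` lines the least, put `k = a + c`, and let `m` be the number of the remaining, middle lines.
Information moves along the lines, so its speed lies between the extreme slopes, and a packet can
never catch up with a line of extreme slope that runs ahead of it (`unreachable_of_ahead`). Hence
* for every middle line `z` and every two extreme lines `e`, `e'`, the packet `{z, e}` fails to
  reach `e'` or the packet `{z, e'}` fails to reach `e`;
* for two lines `e`, `e'` of the same extreme slope and a line `f` of the opposite extreme slope,
  `{e, f}` fails to reach `e'` or `{e', f}` fails to reach `e`.

These are at least `m k (k - 1) / 2 + a c (k - 2) / 2` failures to reach extreme lines. For the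
middle lines, read the sequence from the end and watch the connected components of the packets
read so far. A packet that joins two components reaches nothing outside of their union, and a
potential function (`mergeCost`) shows that the joins cost at least `(m - 1)(m - 2) / 2` failures
altogether, as if the components were joined one point at a time (`le_sum_card_not_canReach`).
Finally `L ≤ m k + a c + (1 - 1 / (s - 2)) m² / 2` by Cauchy-Schwarz, the middle lines having at
most `s - 2` slopes.

*Construction* (`Sweep.exists_network`). Take `m` middle lines close to the first axis, in `s - 2`
blocks of parallel lines that meet each other early, and let `2 h` extreme lines sweep over them
afterwards, one after the other, ascending and descending in turn. Every packet then reaches all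
that the bounds above do not forbid. The pairwise intersections are made to have distinct first
coordinates by adding `δ ^ (i + 1)` to the intercepts, for a small `δ > 0`
(`LineArrangement.exists_generic`).

*Optimization.* For `s ≥ 4` failures to reach the middle lines dominate, a bounded number of
extreme lines is best, and `h = 1` suffices. For `s = 3` the middle lines are parallel, so
`L = m k + a c`, and with `t = √n` the ratio `lost / (n L)` is about `1 / (2 k) + k / (2 n)`, which
is least at `k = t`. The next term turns out to be `-9 / 8 · n⁻¹`, and at the even integer `k`
closest to `t` the remaining error is still of the required sign.
-/

open Finset

/-! ### Failed deliveries and generated networks -/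

namespace CMSN

variable {n : ℕ} (C : CMSN n)

open Classical in
/-- The number of failed deliveries: pairs of a packet and a sensor that the packet cannot
reach. -/
noncomputable def lost : ℕ :=
  ∑ k : Fin C.len, (univ.filter fun x : Fin n => ¬ C.CanReach k x).card

theorem capacity_eq_one_sub (hn : 0 < n) (hL : 0 < C.len) :
    C.capacity = 1 - (C.lost : ℝ) / ((n : ℝ) * (C.len : ℝ)) := by
  classical
  have hn' : (n : ℝ) ≠ 0 := by positivity
  have hL' : (C.len : ℝ) ≠ 0 := by positivity
  have h : (∑ k : Fin C.len, ((univ.filter fun x : Fin n => C.CanReach k x).card : ℝ))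
      + (C.lost : ℝ) = n * C.len := by
    rw [lost, Nat.cast_sum, ← Finset.sum_add_distrib]
    rw [Finset.sum_congr rfl (g := fun _ => (n : ℝ))]
    · simp [mul_comm]
    · intro k _
      rw [← Nat.cast_add, Finset.card_filter_add_card_filter_not]
      simp
  unfold capacity
  rw [eq_sub_of_add_eq h]
  field_simp

theorem capacity_eq_zero_of_len (hL : C.len = 0) : C.capacity = 0 := by
  simp [capacity, hL]

end CMSN

namespace LineArrangement

variable {n : ℕ} (A : LineArrangement n)

/-- The first coordinate of the intersection of the lines `i` and `j`; a junk value if their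
slopes agree. -/
noncomputable def meetTime (i j : Fin n) : ℝ :=
  (A.intercept j - A.intercept i) / (A.slope i - A.slope j)

theorem meetTime_comm (i j : Fin n) : A.meetTime i j = A.meetTime j i := by
  unfold meetTime
  rw [← neg_sub, ← neg_sub (A.slope j), neg_div_neg_eq]

variable {A}

theorem meetAt_iff {i j : Fin n} {x : ℝ} :
    A.MeetAt i j x ↔ A.slope i ≠ A.slope j ∧ x = A.meetTime i j := by
  unfold MeetAt meetTime
  constructor
  · rintro ⟨hij, h⟩
    have hs : A.slope i ≠ A.slope j := by
      intro hs
      apply hij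
      apply A.distinct
      simp only [Prod.mk.injEq]
      refine ⟨hs, ?_⟩
      rw [hs] at h
      linarith
    refine ⟨hs, ?_⟩
    rw [eq_div_iff (sub_ne_zero.2 hs)]
    linarith
  · rintro ⟨hs, h⟩
    refine ⟨fun h' => hs (by rw [h']), ?_⟩
    rw [eq_div_iff (sub_ne_zero.2 hs)] at h
    linarith

namespace Generates

variable {C : CMSN n} (hC : A.Generates C)
include hC

theorem exists_pair (k : Fin C.len) :
    ∃ i j, A.slope i ≠ A.slope j ∧ C.packet k = {i, j} := by
  have h : C.packet k ∈ Set.range C.packet := ⟨k, rfl⟩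
  rw [hC.1] at h
  obtain ⟨i, j, x, hm, hp⟩ := h
  exact ⟨i, j, (meetAt_iff.1 hm).1, hp⟩

theorem exists_index {i j : Fin n} (h : A.slope i ≠ A.slope j) :
    ∃ k, C.packet k = {i, j} := by
  have : ({i, j} : Finset (Fin n)) ∈ Set.range C.packet := by
    rw [hC.1]
    exact ⟨i, j, _, meetAt_iff.2 ⟨h, rfl⟩, rfl⟩
  exact this

theorem slope_ne {k : Fin C.len} {i j : Fin n} (h : C.packet k = {i, j}) :
    A.slope i ≠ A.slope j := by
  obtain ⟨i', j', hs, hp⟩ := hC.exists_pair k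
  have hij : i ≠ j := by
    rintro rfl
    have := C.card_packet k
    simp [h] at this
  rw [h] at hp
  have hi : i ∈ ({i', j'} : Finset (Fin n)) := hp ▸ (by simp)
  have hj : j ∈ ({i', j'} : Finset (Fin n)) := hp ▸ (by simp)
  simp only [mem_insert, mem_singleton] at hi hj
  rcases hi with rfl | rfl <;> rcases hj with rfl | rfl
  · exact absurd rfl hij
  · exact hs
  · exact hs.symm
  · exact absurd rfl hij

theorem meetTime_lt {k l : Fin C.len} (hkl : k < l) {i j i' j' : Fin n}
    (h : C.packet k = {i, j}) (h' : C.packet l = {i', j'}) :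
    A.meetTime i j < A.meetTime i' j' :=
  hC.2 k l i j i' j' _ _ hkl h (meetAt_iff.2 ⟨hC.slope_ne h, rfl⟩) h'
    (meetAt_iff.2 ⟨hC.slope_ne h', rfl⟩)

/-- Two lines meet only once, so no packet is repeated. -/
theorem packet_injective : Function.Injective C.packet := by
  intro k l hkl
  obtain ⟨i, j, -, hp⟩ := hC.exists_pair k
  by_contra hne
  rcases lt_or_gt_of_ne hne with h | h
  · exact lt_irrefl _ (hC.meetTime_lt h hp (hkl ▸ hp))
  · exact lt_irrefl _ (hC.meetTime_lt h (hkl ▸ hp) hp)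

theorem lt_of_meetTime_lt {k l : Fin C.len} {i j i' j' : Fin n}
    (h : C.packet k = {i, j}) (h' : C.packet l = {i', j'})
    (ht : A.meetTime i j < A.meetTime i' j') : k < l := by
  by_contra hlk
  rcases eq_or_lt_of_le (not_lt.1 hlk) with rfl | hlt
  · have hs := hC.slope_ne h
    rw [h] at h'
    have hi : i' ∈ ({i, j} : Finset (Fin n)) := h' ▸ (by simp)
    have hj : j' ∈ ({i, j} : Finset (Fin n)) := h' ▸ (by simp)
    have hs' : i' ≠ j' := by
      rintro rfl
      have := C.card_packet l
      rw [h, h'] at this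
      simp at this
    simp only [mem_insert, mem_singleton] at hi hj
    rcases hi with rfl | rfl <;> rcases hj with rfl | rfl
    · exact hs' rfl
    · exact lt_irrefl _ ht
    · rw [meetTime_comm] at ht
      exact lt_irrefl _ ht
    · exact hs' rfl
  · exact lt_asymm ht (hC.meetTime_lt hlt h' h)

/-- Every packet is counted by two ordered pairs of lines of different slopes. -/
theorem two_mul_len :
    2 * C.len = (univ.filter fun p : Fin n × Fin n => A.slope p.1 ≠ A.slope p.2).card := by
  classical
  have h : (univ.filter fun p : Fin n × Fin n => A.slope p.1 ≠ A.slope p.2)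
      = univ.biUnion fun k : Fin C.len => (C.packet k).offDiag := by
    ext ⟨i, j⟩
    simp only [mem_filter, mem_univ, true_and, mem_biUnion, mem_offDiag]
    constructor
    · intro hs
      obtain ⟨k, hk⟩ := hC.exists_index hs
      exact ⟨k, by simp [hk], by simp [hk], fun h => hs (by rw [h])⟩
    · rintro ⟨k, hi, hj, hij⟩
      apply hC.slope_ne (k := k)
      symm
      apply Finset.eq_of_subset_of_card_le
      · intro x hx
        simp only [mem_insert, mem_singleton] at hx
        rcases hx with rfl | rfl <;> assumption
      · rw [C.card_packet, Finset.card_pair hij]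
  rw [h, Finset.card_biUnion]
  · simp [Finset.offDiag_card, C.card_packet, mul_comm]
  · intro k _ l _ hkl
    rw [Function.onFun, Finset.disjoint_left]
    rintro ⟨i, j⟩ hk hl
    rw [mem_offDiag] at hk hl
    apply hkl
    apply hC.packet_injective
    have key : ∀ k' : Fin C.len, i ∈ C.packet k' → j ∈ C.packet k' →
        ({i, j} : Finset (Fin n)) = C.packet k' := by
      intro k' hi hj
      apply Finset.eq_of_subset_of_card_le
      · intro x hx
        simp only [mem_insert, mem_singleton] at hx
        rcases hx with rfl | rfl <;> assumption
      · rw [C.card_packet, Finset.card_pair hk.2.2]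
    rw [← key k hk.1 hk.2.1, ← key l hl.1 hl.2.1]

theorem len_le : C.len ≤ n * n := by
  have h := hC.two_mul_len
  have h2 := Finset.card_filter_le (univ : Finset (Fin n × Fin n))
    (fun p => A.slope p.1 ≠ A.slope p.2)
  simp only [Finset.card_univ, Fintype.card_prod, Fintype.card_fin] at h2
  omega

end Generates

/-- Sorting the intersections of a generic arrangement by first coordinate. -/
theorem Generic.exists_generates (hA : A.Generic) : ∃ C : CMSN n, A.Generates C := by
  classical
  let S : Finset ℝ := ((univ : Finset (Fin n × Fin n)).filter
    fun p => A.slope p.1 ≠ A.slope p.2).image fun p => A.meetTime p.1 p.2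
  have hS : ∀ x, x ∈ S ↔ ∃ i j, A.MeetAt i j x := by
    intro x
    simp only [S, mem_image, mem_filter, mem_univ, true_and, Prod.exists, meetAt_iff]
    constructor
    · rintro ⟨i, j, h, h'⟩
      exact ⟨i, j, h, h'.symm⟩
    · rintro ⟨i, j, h, h'⟩
      exact ⟨i, j, h, h'.symm⟩
  let e := S.orderIsoOfFin rfl
  have hex : ∀ k : Fin S.card, ∃ i j, A.MeetAt i j (e k) := fun k => (hS _).1 (e k).2
  choose f g hfg using hex
  refine ⟨⟨S.card, fun k => {f k, g k}, fun k => Finset.card_pair (hfg k).1⟩, ?_, ?_⟩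
  · ext p
    constructor
    · rintro ⟨k, rfl⟩
      exact ⟨_, _, _, hfg k, rfl⟩
    · rintro ⟨i, j, x, h, rfl⟩
      refine ⟨e.symm ⟨x, (hS x).2 ⟨i, j, h⟩⟩, ?_⟩
      have := hfg (e.symm ⟨x, (hS x).2 ⟨i, j, h⟩⟩)
      simp only [OrderIso.apply_symm_apply] at this
      exact hA _ _ _ _ _ this h
  · intro k l i j i' j' x x' hkl hk hx hl hx'
    have key : ∀ (k : Fin S.card) (i j : Fin n) (x : ℝ), ({f k, g k} : Finset (Fin n)) = {i, j} →
        A.MeetAt i j x → x = e k := by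
      intro k i j x h hx
      have h1 := meetAt_iff.1 (hfg k)
      have h2 := meetAt_iff.1 hx
      rw [h1.2, h2.2]
      have hi : i ∈ ({f k, g k} : Finset (Fin n)) := h ▸ (by simp)
      have hj : j ∈ ({f k, g k} : Finset (Fin n)) := h ▸ (by simp)
      simp only [mem_insert, mem_singleton] at hi hj
      rcases hi with rfl | rfl <;> rcases hj with rfl | rfl
      · exact absurd rfl h2.1
      · rfl
      · exact meetTime_comm A _ _
      · exact absurd rfl h2.1
    rw [key k i j x hk hx, key l i' j' x' hl hx']
    exact_mod_cast e.strictMono hkl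

end LineArrangement

/-- Parallel lines generate the network without packets. -/
theorem rgmsnCapacities_nonempty (n s : ℕ) (hs : 1 ≤ s) : (rgmsnCapacities n s).Nonempty := by
  let A : LineArrangement n := ⟨fun _ => 0, fun i => (i : ℕ), by
    intro i j h
    simp only [Prod.mk.injEq, true_and, Nat.cast_inj] at h
    exact Fin.ext h⟩
  have hA : A.Generic := by
    intro i j k l x h
    exact absurd rfl (LineArrangement.meetAt_iff.1 h).1
  obtain ⟨C, hC⟩ := hA.exists_generates
  refine ⟨C.capacity, C, ⟨A, ?_, hA, hC⟩, rfl⟩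
  refine le_trans ?_ hs
  rw [LineArrangement.numSlopes, Set.ncard_le_one_iff]
  rintro a b ⟨i, rfl⟩ ⟨j, rfl⟩
  rfl

/-- The capacity is determined by the number of packets and the number of deliveries, both of which
are bounded. -/
theorem rgmsnCapacities_finite (n s : ℕ) : (rgmsnCapacities n s).Finite := by
  classical
  refine Set.Finite.subset (((Finset.range (n * n + 1) ×ˢ
    Finset.range (n * n * n + 1)).finite_toSet).image
    fun p : ℕ × ℕ => 1 / ((n : ℝ) * (p.1 : ℝ)) * (p.2 : ℝ)) ?_
  rintro c ⟨C, ⟨A, -, -, hC⟩, rfl⟩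
  refine ⟨(C.len, ∑ k : Fin C.len, (univ.filter fun x : Fin n => C.CanReach k x).card), ?_, ?_⟩
  · have hL := hC.len_le
    simp only [coe_product, coe_range, Set.mem_prod, Set.mem_Iio]
    refine ⟨by omega, Nat.lt_succ_of_le ?_⟩
    calc _ ≤ ∑ k : Fin C.len, n := by
          refine Finset.sum_le_sum fun k _ => ?_
          simpa using Finset.card_filter_le (univ : Finset (Fin n)) _
      _ = C.len * n := by simp
      _ ≤ _ := Nat.mul_le_mul_right _ hL
  · simp [CMSN.capacity]

theorem isGreatest_rgmsnMaxCapacity (n s : ℕ) (hs : 1 ≤ s) :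
    IsGreatest (rgmsnCapacities n s) (rgmsnMaxCapacity n s) :=
  ⟨(rgmsnCapacities_nonempty n s hs).csSup_mem (rgmsnCapacities_finite n s),
    fun _ hc => le_csSup (rgmsnCapacities_finite n s).bddAbove hc⟩

/-! ### Merging components: a lower bound for connected networks -/

/-- The potential of a component with `b` marked sensors, out of `m` marked sensors in total: the
least number of failed deliveries to marked sensors that building the component costs. -/
noncomputable def mergeCost (m : ℝ) (b : ℕ) : ℝ :=
  if b = 0 then 0 else ((b : ℝ) - 1) * m - (b : ℝ) * (b + 1) / 2 + 1

/-- Joining components with `p` and `q` marked sensors fails to reach the other `m - p - q` ones,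
which pays for the increase of the potential because `(p - 1) * (q - 1) ≥ 0`. -/
theorem mergeCost_add_le (m : ℝ) (p q : ℕ) (h : (p : ℝ) + q ≤ m) :
    mergeCost m (p + q) ≤ mergeCost m p + mergeCost m q + (m - p - q) := by
  unfold mergeCost
  rcases Nat.eq_zero_or_pos p with rfl | hp
  · simp at h ⊢
    linarith
  rcases Nat.eq_zero_or_pos q with rfl | hq
  · simp [hp.ne'] at h ⊢
    linarith
  rw [if_neg (by omega), if_neg (by omega), if_neg (by omega)]
  have hp' : (1 : ℝ) ≤ p := by exact_mod_cast hp
  have hq' : (1 : ℝ) ≤ q := by exact_mod_cast hq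
  push_cast
  nlinarith [mul_nonneg (sub_nonneg.2 hp') (sub_nonneg.2 hq')]

theorem mergeCost_of_le_one (m : ℝ) {b : ℕ} (hb : b ≤ 1) : mergeCost m b = 0 := by
  unfold mergeCost
  interval_cases b
  · simp
  · norm_num

/-- Redirecting the label `v` to the label `u` joins two components; the total potential grows by
at most the number of marked points outside both. -/
theorem sum_mergeCost_merge {α β : Type*} [Fintype β] [DecidableEq β] (B : Finset α)
    (f : α → β) {u v : β} (huv : u ≠ v) :
    ∑ l, mergeCost B.card (B.filter fun x => (if f x = v then u else f x) = l).card ≤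
      ∑ l, mergeCost B.card (B.filter fun x => f x = l).card +
        ((B.filter fun x => f x ≠ u ∧ f x ≠ v).card : ℝ) := by
  classical
  have hsplit : ∀ g : β → ℝ, ∑ l, g l = ∑ l ∈ (univ.erase u).erase v, g l + g u + g v := by
    intro g
    rw [← Finset.add_sum_erase univ g (mem_univ u),
      ← Finset.add_sum_erase (univ.erase u) g (mem_erase.2 ⟨huv.symm, mem_univ v⟩)]
    ring
  rw [hsplit, hsplit]
  have h1 : ∀ l ∈ (univ.erase u).erase v,
      (B.filter fun x => (if f x = v then u else f x) = l) = B.filter fun x => f x = l := by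
    intro l hl
    simp only [mem_erase, mem_univ, and_true] at hl
    apply Finset.filter_congr
    intro x _
    split_ifs with h
    · constructor
      · intro h'
        exact absurd h'.symm hl.2
      · intro h'
        exact absurd (h'.symm.trans h) hl.1
    · rfl
  rw [Finset.sum_congr rfl (fun l hl => by rw [h1 l hl])]
  have hu : (B.filter fun x => (if f x = v then u else f x) = u).card
      = (B.filter fun x => f x = u).card + (B.filter fun x => f x = v).card := by
    rw [← Finset.card_union_of_disjoint]
    · congr 1
      ext x
      simp only [mem_filter, mem_union]
      split_ifs with h
      · simp [h, huv.symm]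
      · simp [h]
    · rw [Finset.disjoint_filter]
      intro x _ h h'
      exact huv (h.symm.trans h')
  have hv : (B.filter fun x => (if f x = v then u else f x) = v) = ∅ := by
    apply Finset.filter_eq_empty_iff.2
    intro x _
    split_ifs with h
    · exact huv
    · exact h
  have hrest : (B.filter fun x => f x = u).card + (B.filter fun x => f x = v).card
      + (B.filter fun x => f x ≠ u ∧ f x ≠ v).card = B.card := by
    rw [← Finset.card_union_of_disjoint, ← Finset.filter_or,
      ← Finset.card_filter_add_card_filter_not (s := B) (fun x => f x = u ∨ f x = v)]
    · simp only [not_or, ne_eq]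
    · rw [Finset.disjoint_filter]
      intro x _ h h'
      exact huv (h.symm.trans h')
  have hrest' : ((B.filter fun x => f x = u).card : ℝ) + ((B.filter fun x => f x = v).card : ℝ)
      + ((B.filter fun x => f x ≠ u ∧ f x ≠ v).card : ℝ) = B.card := by
    exact_mod_cast hrest
  have := mergeCost_add_le (B.card : ℝ) (B.filter fun x => f x = u).card
    (B.filter fun x => f x = v).card (by
      have : (0 : ℝ) ≤ ((B.filter fun x => f x ≠ u ∧ f x ≠ v).card : ℝ) := by positivity
      linarith)
  rw [hu, hv, Finset.card_empty, mergeCost_of_le_one _ (b := 0) zero_le_one]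
  linarith

namespace CMSN

variable {n : ℕ} (C : CMSN n)

theorem le_of_reflTransGen_hop {k l : Fin C.len} (h : Relation.ReflTransGen C.Hop k l) :
    k ≤ l := by
  induction h with
  | refl => exact le_rfl
  | tail _ h ih => exact ih.trans h.1.le

/-- A labelling that is constant on every packet from index `k` on is constant along every
chain starting there. -/
theorem label_eq_of_canReach {β : Type*} (f : Fin n → β) {k : Fin C.len}
    (hf : ∀ l, k ≤ l → ∀ i ∈ C.packet l, ∀ j ∈ C.packet l, f i = f j) {x : Fin n}
    (hx : C.CanReach k x) {i : Fin n} (hi : i ∈ C.packet k) : f x = f i := by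
  obtain ⟨l, hl, hxl⟩ := hx
  induction hl generalizing x with
  | refl => exact hf k le_rfl _ hxl _ hi
  | @tail b c hb hbc ih =>
    obtain ⟨y, hy⟩ := hbc.2
    rw [mem_inter] at hy
    rw [hf c ((C.le_of_reflTransGen_hop hb).trans hbc.1.le) x hxl y hy.2]
    exact ih hy.1

open Classical in
/-- After the last `t` packets there is a labelling of the sensors by components, whose total
potential is at most the number of failed deliveries of these packets to `B`. -/
theorem exists_label (B : Finset (Fin n)) (t : ℕ) (ht : t ≤ C.len) :
    ∃ f : Fin n → Fin n,
      (∀ l : Fin C.len, C.len - t ≤ l → ∀ i ∈ C.packet l, ∀ j ∈ C.packet l, f i = f j) ∧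
      ∑ l, mergeCost B.card (B.filter fun x => f x = l).card ≤
        ∑ k ∈ univ.filter (fun k : Fin C.len => C.len - t ≤ k),
          ((B.filter fun x => ¬ C.CanReach k x).card : ℝ) := by
  induction t with
  | zero =>
    refine ⟨id, fun l hl => absurd l.2 (by omega), ?_⟩
    rw [Finset.sum_eq_zero]
    · positivity
    · intro l _
      apply mergeCost_of_le_one
      rw [Finset.card_le_one]
      intro a ha b hb
      simp only [id, mem_filter] at ha hb
      rw [ha.2, hb.2]
  | succ t ih =>
    obtain ⟨f, hf, hsum⟩ := ih (by omega)
    let k : Fin C.len := ⟨C.len - (t + 1), by omega⟩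
    obtain ⟨i, j, -, hij⟩ := Finset.card_eq_two.1 (C.card_packet k)
    have hlt : ∀ l : Fin C.len, C.len - (t + 1) ≤ l → l = k ∨ C.len - t ≤ l := by
      intro l hl
      by_cases h : l = k
      · exact Or.inl h
      · right
        have : (l : ℕ) ≠ C.len - (t + 1) := fun h' => h (Fin.ext h')
        omega
    have hfilter : univ.filter (fun l : Fin C.len => C.len - (t + 1) ≤ l) =
        insert k (univ.filter fun l : Fin C.len => C.len - t ≤ l) := by
      ext l
      simp only [mem_filter, mem_univ, true_and, mem_insert]
      refine ⟨hlt l, ?_⟩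
      rintro (rfl | h)
      · exact le_rfl
      · omega
    rw [hfilter, Finset.sum_insert (by simp [k]; omega)]
    -- join the components of the two sensors of packet `k` by redirecting a label
    let f' : Fin n → Fin n := fun x => if f x = f j then f i else f x
    have hf' : ∀ l : Fin C.len, C.len - (t + 1) ≤ l →
        ∀ a ∈ C.packet l, ∀ b ∈ C.packet l, f' a = f' b := by
      intro l hl a ha b hb
      rcases hlt l hl with rfl | h
      · rw [hij, mem_insert, mem_singleton] at ha hb
        have : ∀ a, a = i ∨ a = j → f' a = f i := by
          rintro a (rfl | rfl)
          · simp [f']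
          · simp [f']
        rw [this a ha, this b hb]
      · simp only [f', hf l h a ha b hb]
    refine ⟨f', hf', ?_⟩
    by_cases hne : f i = f j
    · have : f' = f := by
        funext x
        simp only [f', hne]
        split_ifs with h
        · exact h.symm
        · rfl
      rw [this]
      have h0 : (0 : ℝ) ≤ ((B.filter fun x => ¬ C.CanReach k x).card : ℝ) := by positivity
      linarith
    · have h1 := sum_mergeCost_merge B f hne
      have h2 : (B.filter fun x => f x ≠ f i ∧ f x ≠ f j).card ≤
          (B.filter fun x => ¬ C.CanReach k x).card := by
        apply Finset.card_le_card
        intro x hx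
        simp only [mem_filter] at hx ⊢
        refine ⟨hx.1, fun hr => ?_⟩
        have h3 := C.label_eq_of_canReach f' (fun l hl => hf' l (by exact_mod_cast hl)) hr
          (i := i) (by rw [hij]; simp)
        simp only [f', hne, if_false, hx.2.2] at h3
        exact hx.2.1 h3
      have h2' : ((B.filter fun x => f x ≠ f i ∧ f x ≠ f j).card : ℝ) ≤
          ((B.filter fun x => ¬ C.CanReach k x).card : ℝ) := by exact_mod_cast h2
      have h3 : ∑ l, mergeCost B.card (B.filter fun x => f' x = l).card =
        ∑ l, mergeCost B.card (B.filter fun x => (if f x = f j then f i else f x) = l).card := rfl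
      rw [h3]
      linarith

open Classical in
/-- In a connected network the packets miss the sensors of `B` at least `(m - 1)(m - 2)/2` times,
where `m` is the size of `B`. -/
theorem le_sum_card_not_canReach (B : Finset (Fin n)) (hB : B.Nonempty)
    (hconn : ∀ f : Fin n → Fin n,
      (∀ k, ∀ i ∈ C.packet k, ∀ j ∈ C.packet k, f i = f j) → ∀ i j, f i = f j) :
    ((B.card : ℝ) - 1) * ((B.card : ℝ) - 2) / 2 ≤
      ∑ k, ((B.filter fun x => ¬ C.CanReach k x).card : ℝ) := by
  obtain ⟨f, hf, hsum⟩ := C.exists_label B C.len le_rfl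
  simp only [Nat.sub_self, zero_le, filter_true] at hsum
  refine le_trans (le_of_eq ?_) hsum
  obtain ⟨b, hb⟩ := hB
  have hc := hconn f (fun k => hf k (by simp))
  rw [Finset.sum_eq_single (f b)]
  · rw [Finset.filter_true_of_mem (fun x _ => hc x b)]
    have : B.card ≠ 0 := (Finset.card_pos.2 ⟨b, hb⟩).ne'
    rw [mergeCost, if_neg this]
    ring
  · intro l _ hl
    rw [Finset.filter_false_of_mem (fun x _ h => hl (h.symm.trans (hc x b)))]
    exact mergeCost_of_le_one _ (by simp)
  · simp

end CMSN

/-! ### Speed limits for information, and counting pairs -/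

/-- If a relation holds, in one direction or the other, between any two elements of `S`, then it
holds for at least half of the ordered pairs; this is the count over a family of such relations. -/
theorem card_mul_le_two_mul_card_filter {α β : Type*} [DecidableEq α] [DecidableEq β] (P : Finset β)
    (S : Finset α) (R : β → α → α → Prop) [∀ z, DecidableRel (R z)]
    (hR : ∀ z ∈ P, ∀ e ∈ S, ∀ e' ∈ S, e ≠ e' → R z e e' ∨ R z e' e) :
    P.card * (S.card * S.card - S.card) ≤
      2 * ((P ×ˢ S.offDiag).filter fun p => R p.1 p.2.1 p.2.2).card := by
  have h1 : ((P ×ˢ S.offDiag).filter fun p => R p.1 p.2.2 p.2.1).card =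
      ((P ×ˢ S.offDiag).filter fun p => R p.1 p.2.1 p.2.2).card := by
    apply Finset.card_bij (fun p _ => (p.1, p.2.swap))
    · rintro ⟨z, e, e'⟩ h
      simp only [mem_filter, mem_product, mem_offDiag, Prod.swap, ne_eq] at h ⊢
      exact ⟨⟨h.1.1, h.1.2.2.1, h.1.2.1, fun h' => h.1.2.2.2 h'.symm⟩, h.2⟩
    · rintro ⟨z, e, e'⟩ - ⟨w, d, d'⟩ - h
      simp only [Prod.swap, Prod.mk.injEq] at h ⊢
      exact ⟨h.1, h.2.2, h.2.1⟩
    · rintro ⟨z, e, e'⟩ h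
      simp only [mem_filter, mem_product, mem_offDiag, ne_eq] at h
      refine ⟨(z, e', e), ?_, rfl⟩
      simp only [mem_filter, mem_product, mem_offDiag, ne_eq]
      exact ⟨⟨h.1.1, h.1.2.2.1, h.1.2.1, fun h' => h.1.2.2.2 h'.symm⟩, h.2⟩
  have h2 : P ×ˢ S.offDiag ⊆ ((P ×ˢ S.offDiag).filter fun p => R p.1 p.2.1 p.2.2) ∪
      ((P ×ˢ S.offDiag).filter fun p => R p.1 p.2.2 p.2.1) := by
    rintro ⟨z, e, e'⟩ h
    have h' := h
    simp only [mem_product, mem_offDiag, ne_eq] at h'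
    rw [mem_union, mem_filter, mem_filter]
    rcases hR z h'.1 e h'.2.1 e' h'.2.2.1 h'.2.2.2 with h3 | h3
    · exact Or.inl ⟨h, h3⟩
    · exact Or.inr ⟨h, h3⟩
  have h3 := (Finset.card_le_card h2).trans (Finset.card_union_le _ _)
  rw [h1, Finset.card_product, Finset.offDiag_card] at h3
  omega

theorem Finset.pair_eq_pair_cases {α : Type*} [DecidableEq α] {i j i' j' : α}
    (h : ({i, j} : Finset α) = {i', j'}) : (i = i' ∧ j = j') ∨ (i = j' ∧ j = i') := by
  have h' := congrArg (fun s : Finset α => (s : Set α)) h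
  simp only [coe_insert, coe_singleton] at h'
  exact Set.pair_eq_pair_iff.1 h'

/-- The number of pairs in `B` on which `f` agrees is at least `|B|²` divided by the number of
values of `f`. -/
theorem card_sq_le_mul_card_agree {α β : Type*} [DecidableEq β] (B : Finset α)
    (f : α → β) (r : ℕ) (hr : (B.image f).card ≤ r) :
    B.card ^ 2 ≤ r * ((B ×ˢ B).filter fun p => f p.1 = f p.2).card := by
  have h1 : ((B ×ˢ B).filter fun p => f p.1 = f p.2).card =
      ∑ v ∈ B.image f, (B.filter fun i => f i = v).card ^ 2 := by
    rw [Finset.card_eq_sum_card_fiberwise (f := fun p => f p.1) (t := B.image f)]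
    · refine Finset.sum_congr rfl fun v _ => ?_
      rw [sq, ← Finset.card_product]
      congr 1
      ext ⟨i, j⟩
      simp only [mem_filter, mem_product]
      constructor
      · rintro ⟨⟨⟨hi, hj⟩, h⟩, rfl⟩
        exact ⟨⟨hi, rfl⟩, hj, h.symm⟩
      · rintro ⟨⟨hi, rfl⟩, hj, h⟩
        exact ⟨⟨⟨hi, hj⟩, h.symm⟩, rfl⟩
    · intro p hp
      simp only [coe_filter, mem_product, Set.mem_ofPred_eq] at hp
      exact Finset.mem_coe.2 (Finset.mem_image_of_mem _ hp.1.1)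
  have h2 : B.card = ∑ v ∈ B.image f, (B.filter fun i => f i = v).card :=
    Finset.card_eq_sum_card_image f B
  rw [h1]
  calc B.card ^ 2 = (∑ v ∈ B.image f, (B.filter fun i => f i = v).card) ^ 2 := by rw [← h2]
    _ ≤ (B.image f).card * ∑ v ∈ B.image f, (B.filter fun i => f i = v).card ^ 2 :=
        sq_sum_le_card_mul_sum_sq
    _ ≤ _ := Nat.mul_le_mul_right _ hr

namespace LineArrangement

variable {n : ℕ} (A : LineArrangement n)

/-- The second coordinate of the line `i` above `t`. -/
def pos (i : Fin n) (t : ℝ) : ℝ := A.slope i * t + A.intercept i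

variable {A}

theorem pos_sub_pos {i j : Fin n} (h : A.slope i ≠ A.slope j) (t : ℝ) :
    A.pos i t - A.pos j t = (A.slope i - A.slope j) * (t - A.meetTime i j) := by
  have := sub_ne_zero.2 h
  unfold pos meetTime
  field_simp
  ring

/-- No chain of hops starting from the intersection of `i` and `j` reaches `x`. -/
def Unreachable (C : CMSN n) (i j x : Fin n) : Prop :=
  ∀ k, C.packet k = {i, j} → ¬ C.CanReach k x

theorem Unreachable.swap {C : CMSN n} {i j x : Fin n} (h : Unreachable C i j x) :
    Unreachable C j i x :=
  fun k hk => h k (by rw [hk, Finset.pair_comm])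

namespace Generates

variable {C : CMSN n} (hC : A.Generates C)
include hC

/-- Each packet has a time, increasing along the sequence, at which its two lines are at the same
height. -/
theorem exists_time : ∃ τ : Fin C.len → ℝ, StrictMono τ ∧
    (∀ k i j, C.packet k = {i, j} → τ k = A.meetTime i j) ∧
    ∀ k, ∀ i ∈ C.packet k, ∀ j ∈ C.packet k, A.pos i (τ k) = A.pos j (τ k) := by
  choose f g hs hp using hC.exists_pair
  have hτ : ∀ k i j, C.packet k = {i, j} → A.meetTime (f k) (g k) = A.meetTime i j := by
    intro k i j h
    rcases Finset.pair_eq_pair_cases ((hp k).symm.trans h) with ⟨h1, h2⟩ | ⟨h1, h2⟩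
    · rw [h1, h2]
    · rw [h1, h2, meetTime_comm]
  have hpos : ∀ k, A.pos (f k) (A.meetTime (f k) (g k)) = A.pos (g k) (A.meetTime (f k) (g k)) := by
    intro k
    rw [← sub_eq_zero, pos_sub_pos (hs k), sub_self, mul_zero]
  refine ⟨fun k => A.meetTime (f k) (g k), fun k l hkl => hC.meetTime_lt hkl (hp k) (hp l), hτ, ?_⟩
  intro k i hi j hj
  rw [hp, mem_insert, mem_singleton] at hi hj
  rcases hi with rfl | rfl <;> rcases hj with rfl | rfl
  · rfl
  · exact hpos k
  · exact (hpos k).symm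
  · rfl

/-- Information travels with a speed between the extreme slopes: it cannot catch up with a line
of extreme slope that runs ahead of it. Here `σ` is positive for the greatest slope and negative
for the least. -/
theorem unreachable_of_ahead {σ : ℝ} {x : Fin n}
    (hσ : ∀ i, 0 ≤ σ * (A.slope x - A.slope i)) {i j : Fin n}
    (h : 0 < σ * (A.pos x (A.meetTime i j) - A.pos i (A.meetTime i j))) :
    Unreachable C i j x := by
  obtain ⟨τ, hτ, hτm, hpos⟩ := hC.exists_time
  intro k hk hreach
  obtain ⟨l, hl, hxl⟩ := hreach
  have key : ∃ y ∈ C.packet l, 0 < σ * (A.pos x (τ l) - A.pos y (τ l)) := by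
    clear hxl
    induction hl with
    | refl => exact ⟨i, by rw [hk]; simp, by rw [hτm k i j hk]; exact h⟩
    | @tail b c _ hbc ih =>
      obtain ⟨y, hy, hlt⟩ := ih
      obtain ⟨w, hw⟩ := hbc.2
      rw [mem_inter] at hw
      refine ⟨w, hw.2, ?_⟩
      rw [hpos b y hy w hw.1] at hlt
      have h1 := mul_nonneg (hσ w) (sub_nonneg.2 (hτ hbc.1).le)
      have h2 : σ * (A.pos x (τ c) - A.pos w (τ c)) = σ * (A.pos x (τ b) - A.pos w (τ b)) +
          σ * (A.slope x - A.slope w) * (τ c - τ b) := by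
        unfold pos
        ring
      linarith
  obtain ⟨y, hy, hlt⟩ := key
  rw [hpos l x hxl y hy, sub_self, mul_zero] at hlt
  exact lt_irrefl _ hlt

/-- Of two parallel extreme lines, the one behind meets `j` in a packet that the other outruns. -/
theorem unreachable_or_of_parallel {σ : ℝ} (hσ0 : σ ≠ 0) {c c' : Fin n} (hcc : c ≠ c')
    (hs : A.slope c = A.slope c') (hσ : ∀ i, 0 ≤ σ * (A.slope c - A.slope i)) (j : Fin n) :
    Unreachable C c j c' ∨ Unreachable C c' j c := by
  have hb : σ * A.intercept c ≠ σ * A.intercept c' := by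
    intro h
    exact hcc (A.distinct (by simp only [hs, mul_left_cancel₀ hσ0 h]))
  rcases lt_or_gt_of_ne hb with h | h
  · left
    apply hC.unreachable_of_ahead (σ := σ) (by rwa [← hs])
    unfold pos
    rw [hs]
    linarith
  · right
    apply hC.unreachable_of_ahead (σ := σ) hσ
    unfold pos
    rw [hs]
    linarith

/-- Of two opposite extreme lines, the one that meets `z` first is out of reach for the packet of
the later meeting. -/
theorem unreachable_or_of_opposite (hA : A.Generic) {z c a : Fin n}
    (hc : ∀ i, A.slope i ≤ A.slope c) (ha : ∀ i, A.slope a ≤ A.slope i)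
    (hzc : A.slope z ≠ A.slope c) (hza : A.slope z ≠ A.slope a) :
    Unreachable C z c a ∨ Unreachable C z a c := by
  have h1 : A.slope z < A.slope c := lt_of_le_of_ne (hc z) hzc
  have h2 : A.slope a < A.slope z := lt_of_le_of_ne (ha z) hza.symm
  have hne : A.meetTime z c ≠ A.meetTime z a := by
    intro h
    have := hA z c z a _ (meetAt_iff.2 ⟨hzc, rfl⟩) (meetAt_iff.2 ⟨hza, h⟩)
    rcases Finset.pair_eq_pair_cases this with ⟨-, h3⟩ | ⟨-, h3⟩
    · rw [h3] at h1
      exact lt_asymm h1 h2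
    · exact hzc (by rw [h3])
  rcases lt_or_gt_of_ne hne with h | h
  · right
    apply hC.unreachable_of_ahead (σ := 1) (fun i => by linarith [hc i])
    have := pos_sub_pos hzc (A.meetTime z a)
    nlinarith [mul_pos (sub_pos.2 h1) (sub_pos.2 h)]
  · left
    apply hC.unreachable_of_ahead (σ := -1) (fun i => by linarith [ha i])
    have := pos_sub_pos hza (A.meetTime z c)
    nlinarith [mul_pos (sub_pos.2 h2) (sub_pos.2 h)]

open Classical in
/-- Failed deliveries to a set `E` of sensors may be counted by triples `((i, j), x)` in which the
pair of lines is oriented by a rank function. -/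
theorem card_le_sum_card_not_canReach (E : Finset (Fin n)) (ρ : Fin n → ℕ)
    (T : Finset ((Fin n × Fin n) × Fin n))
    (hT : ∀ t ∈ T, ρ t.1.1 < ρ t.1.2 ∧ A.slope t.1.1 ≠ A.slope t.1.2 ∧ t.2 ∈ E ∧
      Unreachable C t.1.1 t.1.2 t.2) :
    T.card ≤ ∑ k, (E.filter fun x => ¬ C.CanReach k x).card := by
  have h1 : ∑ k, (E.filter fun x => ¬ C.CanReach k x).card =
      (((univ : Finset (Fin C.len)) ×ˢ E).filter fun p => ¬ C.CanReach p.1 p.2).card := by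
    rw [Finset.card_filter, Finset.sum_product]
    simp only [Finset.card_filter]
  rw [h1, ← Finset.card_image_of_injOn (s := T)
    (f := fun t => (({t.1.1, t.1.2} : Finset (Fin n)), t.2))]
  · refine le_trans (Finset.card_le_card ?_)
      (Finset.card_image_le (f := fun p : Fin C.len × Fin n => (C.packet p.1, p.2)))
    intro p hp
    obtain ⟨⟨⟨i, j⟩, x⟩, ht, rfl⟩ := Finset.mem_image.1 hp
    obtain ⟨-, hs, hx, hu⟩ := hT _ ht
    obtain ⟨k, hk⟩ := hC.exists_index hs
    refine Finset.mem_image.2 ⟨(k, x), ?_, ?_⟩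
    · simp only [mem_filter, mem_product, mem_univ, true_and]
      exact ⟨hx, hu k hk⟩
    · simp only [hk]
  · rintro ⟨⟨i, j⟩, x⟩ ht ⟨⟨i', j'⟩, x'⟩ ht' h
    have h2 := (hT _ ht).1
    have h3 := (hT _ ht').1
    simp only [Prod.mk.injEq] at h h2 h3 ⊢
    refine ⟨?_, h.2⟩
    rcases Finset.pair_eq_pair_cases h.1 with h4 | ⟨rfl, rfl⟩
    · exact h4
    · omega

end Generates

end LineArrangement

/-! ### Lower bound on failed deliveries for few slopes -/

namespace LineArrangement

variable {n : ℕ} {A : LineArrangement n}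

/-- Two bounds that hold for every restricted network with at least one packet. Here `c` and `a`
are the numbers of lines of greatest and of least slope, and `m` is the number of all others. The term
`m (m - 3) / 2`, slightly less than `(m - 1)(m - 2) / 2`, is correct for `m = 0` as well. -/
theorem Generates.exists_bounds {C : CMSN n} (hC : A.Generates C) (hA : A.Generic) {s : ℕ}
    (hs : A.numSlopes ≤ s) (hs2 : 3 ≤ s) (hL : 0 < C.len) :
    ∃ a c m : ℕ, 1 ≤ a ∧ 1 ≤ c ∧ m + (a + c) = n ∧
      (C.len : ℝ) ≤ m * (a + c) + a * c + (1 - 1 / ((s : ℝ) - 2)) * m ^ 2 / 2 ∧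
      (m : ℝ) * (m - 3) / 2 + m * ((a + c) * (a + c - 1)) / 2
        + a * c * (a + c - 2) / 2 ≤ C.lost := by
  classical
  obtain ⟨i₀, j₀, hij₀, -⟩ := hC.exists_pair ⟨0, hL⟩
  have : Nonempty (Fin n) := ⟨i₀⟩
  obtain ⟨v, hv⟩ := Finite.exists_max A.slope
  obtain ⟨u, hu⟩ := Finite.exists_min A.slope
  have huv : A.slope u ≠ A.slope v := by
    intro h
    exact hij₀ (le_antisymm ((hv i₀).trans (h ▸ hu j₀)) ((hv j₀).trans (h ▸ hu i₀)))
  set As := univ.filter fun i => A.slope i = A.slope u with hAs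
  set Cs := univ.filter fun i => A.slope i = A.slope v with hCs
  set Bs := univ.filter fun i => A.slope i ≠ A.slope u ∧ A.slope i ≠ A.slope v with hBs
  have mA : ∀ i, i ∈ As ↔ A.slope i = A.slope u := by simp [hAs]
  have mC : ∀ i, i ∈ Cs ↔ A.slope i = A.slope v := by simp [hCs]
  have mB : ∀ i, i ∈ Bs ↔ A.slope i ≠ A.slope u ∧ A.slope i ≠ A.slope v := by simp [hBs]
  have hdAC : Disjoint As Cs := by
    rw [Finset.disjoint_left]
    intro i hi hi'
    rw [mA] at hi
    rw [mC] at hi'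
    exact huv (hi.symm.trans hi')
  have hdB : Disjoint Bs (As ∪ Cs) := by
    rw [Finset.disjoint_left]
    intro i hi hi'
    rw [mB] at hi
    rw [mem_union, mA, mC] at hi'
    tauto
  have hcover : Bs ∪ (As ∪ Cs) = univ := by
    ext i
    simp only [mem_union, mA, mB, mC, mem_univ, iff_true]
    tauto
  have hE : (As ∪ Cs).card = As.card + Cs.card := Finset.card_union_of_disjoint hdAC
  have hcard : Bs.card + (As.card + Cs.card) = n := by
    rw [← hE, ← Finset.card_union_of_disjoint hdB, hcover]
    simp
  refine ⟨As.card, Cs.card, Bs.card, Finset.card_pos.2 ⟨u, by rw [mA]⟩,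
    Finset.card_pos.2 ⟨v, by rw [mC]⟩, hcard, ?_, ?_⟩
  · -- the pairs of equal slopes, class by class
    have himage : (Bs.image A.slope).card ≤ s - 2 := by
      have h1 : (univ.image A.slope).card ≤ s := by
        refine le_trans (le_of_eq ?_) hs
        rw [numSlopes, ← Set.ncard_coe_finset]
        simp
      have h2 : Bs.image A.slope ⊆ ((univ.image A.slope).erase (A.slope u)).erase (A.slope v) := by
        intro x hx
        obtain ⟨i, hi, rfl⟩ := Finset.mem_image.1 hx
        rw [mB] at hi
        simp only [mem_erase]
        exact ⟨hi.2, hi.1, Finset.mem_image_of_mem _ (mem_univ _)⟩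
      have h3 := Finset.card_le_card h2
      rw [Finset.card_erase_of_mem, Finset.card_erase_of_mem] at h3
      · omega
      · simp
      · simp only [mem_erase]
        exact ⟨huv.symm, Finset.mem_image_of_mem _ (mem_univ _)⟩
    have hsq := card_sq_le_mul_card_agree Bs A.slope (s - 2) himage
    set D := ((Bs ×ˢ Bs).filter fun p => A.slope p.1 = A.slope p.2).card with hD
    have hsame : As.card * As.card + Cs.card * Cs.card + D ≤
        (univ.filter fun p : Fin n × Fin n => A.slope p.1 = A.slope p.2).card := by
      rw [← Finset.card_product, ← Finset.card_product, hD, ← Finset.card_union_of_disjoint,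
        ← Finset.card_union_of_disjoint]
      · apply Finset.card_le_card
        rintro ⟨i, j⟩ h
        simp only [mem_union, mem_product, mem_filter, mem_univ, true_and, mA, mC] at h ⊢
        rcases h with (⟨h1, h2⟩ | ⟨h1, h2⟩) | ⟨-, h⟩
        · rw [h1, h2]
        · rw [h1, h2]
        · exact h
      · rw [Finset.disjoint_left]
        rintro ⟨i, j⟩ h h'
        simp only [mem_union, mem_product, mem_filter, mA, mC, mB] at h h'
        tauto
      · rw [Finset.disjoint_left]
        rintro ⟨i, j⟩ h h'
        simp only [mem_product] at h h'
        exact Finset.disjoint_left.1 hdAC h.1 h'.1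
    have h2L : 2 * C.len = (univ.filter fun p : Fin n × Fin n =>
        ¬ A.slope p.1 = A.slope p.2).card := by
      convert hC.two_mul_len
    have htot := Finset.card_filter_add_card_filter_not (s := (univ : Finset (Fin n × Fin n)))
      (fun p => A.slope p.1 = A.slope p.2)
    simp only [Finset.card_univ, Fintype.card_prod, Fintype.card_fin] at htot
    have hmain : 2 * C.len + (As.card * As.card + Cs.card * Cs.card + D) ≤ n * n := by
      rw [h2L]
      omega
    have hmain' : 2 * (C.len : ℝ) + ((As.card : ℝ) * As.card + (Cs.card : ℝ) * Cs.card + D)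
        ≤ (n : ℝ) * n := by exact_mod_cast hmain
    have hn : (n : ℝ) = Bs.card + (As.card + Cs.card) := by exact_mod_cast hcard.symm
    have hs' : (1 : ℝ) ≤ (s : ℝ) - 2 := by
      have : (3 : ℝ) ≤ s := by exact_mod_cast hs2
      linarith
    have hsq' : (Bs.card : ℝ) ^ 2 ≤ ((s : ℝ) - 2) * D := by
      have : (((s - 2 : ℕ)) : ℝ) = (s : ℝ) - 2 := by
        rw [Nat.cast_sub (by omega)]
        norm_num
      rw [← this]
      exact_mod_cast hsq
    have hD' : 1 / ((s : ℝ) - 2) * (Bs.card : ℝ) ^ 2 ≤ D := by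
      rw [one_div, inv_mul_le_iff₀ (by linarith)]
      exact hsq'
    rw [hn] at hmain'
    linarith
  · -- failed deliveries to the middle lines, and to the extreme ones
    have hsplit : (C.lost : ℝ) = ∑ k, ((Bs.filter fun x => ¬ C.CanReach k x).card : ℝ) +
        (∑ k, ((As ∪ Cs).filter fun x => ¬ C.CanReach k x).card : ℕ) := by
      rw [CMSN.lost, Nat.cast_sum, Nat.cast_sum, ← Finset.sum_add_distrib]
      refine Finset.sum_congr rfl fun k _ => ?_
      rw [← Nat.cast_add, ← Finset.card_union_of_disjoint (Finset.disjoint_filter_filter hdB),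
        ← Finset.filter_union, hcover]
    have hmid : (Bs.card : ℝ) * (Bs.card - 3) / 2 ≤
        ∑ k, ((Bs.filter fun x => ¬ C.CanReach k x).card : ℝ) := by
      rcases Finset.eq_empty_or_nonempty Bs with h | h
      · rw [h]
        simp
      · refine le_trans ?_ (C.le_sum_card_not_canReach Bs h ?_)
        · linarith
        intro f hf
        have hne : ∀ i j, A.slope i ≠ A.slope j → f i = f j := by
          intro i j hij
          obtain ⟨k, hk⟩ := hC.exists_index hij
          exact hf k i (by rw [hk]; simp) j (by rw [hk]; simp)
        intro i j
        by_cases hij : A.slope i = A.slope j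
        · by_cases hiu : A.slope i = A.slope u
          · exact (hne i v (by rw [hiu]; exact huv)).trans
              (hne j v (by rw [← hij, hiu]; exact huv)).symm
          · exact (hne i u hiu).trans (hne j u (by rwa [← hij])).symm
        · exact hne i j hij
    -- `R i j x`: the packet of `i` and `j` does not reach `x`
    set R : Fin n → Fin n → Fin n → Prop := fun i j x => Unreachable C i j x with hR
    have hmaxσ : ∀ c, A.slope c = A.slope v → ∀ i, 0 ≤ (1 : ℝ) * (A.slope c - A.slope i) := by
      intro c hc i
      have := hv i
      rw [hc]
      linarith
    have hminσ : ∀ a, A.slope a = A.slope u → ∀ i, 0 ≤ (-1 : ℝ) * (A.slope a - A.slope i) := by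
      intro a ha i
      have := hu i
      rw [ha]
      linarith
    have hmaxR : ∀ j, ∀ c ∈ Cs, ∀ c' ∈ Cs, c ≠ c' → R c j c' ∨ R c' j c := by
      intro j c hc c' hc' hne
      rw [mC] at hc hc'
      exact hC.unreachable_or_of_parallel one_ne_zero hne (hc.trans hc'.symm) (hmaxσ c hc) j
    have hminR : ∀ j, ∀ a ∈ As, ∀ a' ∈ As, a ≠ a' → R a j a' ∨ R a' j a := by
      intro j a ha a' ha' hne
      rw [mA] at ha ha'
      exact hC.unreachable_or_of_parallel (neg_ne_zero.2 one_ne_zero) hne (ha.trans ha'.symm)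
        (hminσ a ha) j
    have hswap : ∀ {i j x}, R i j x → R j i x := fun h => Unreachable.swap h
    have hoppR : ∀ z ∈ Bs, ∀ c ∈ Cs, ∀ a ∈ As, R z c a ∨ R z a c := by
      intro z hz c hc a ha
      rw [mB] at hz
      rw [mC] at hc
      rw [mA] at ha
      refine hC.unreachable_or_of_opposite hA (fun i => ?_) (fun i => ?_) ?_ ?_
      · rw [hc]; exact hv i
      · rw [ha]; exact hu i
      · rw [hc]; exact hz.2
      · rw [ha]; exact hz.1
    have c1 := card_mul_le_two_mul_card_filter Bs (As ∪ Cs) R (by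
      intro z hz e he e' he' hne
      rw [mem_union] at he he'
      rcases he with he | he <;> rcases he' with he' | he'
      · exact (hminR z e he e' he' hne).imp hswap hswap
      · exact (hoppR z hz e' he' e he).symm
      · exact hoppR z hz e he e' he'
      · exact (hmaxR z e he e' he' hne).imp hswap hswap)
    have c2 := card_mul_le_two_mul_card_filter As Cs (fun a c c' => R c a c')
      (fun a _ => hmaxR a)
    have c3 := card_mul_le_two_mul_card_filter Cs As (fun c a a' => R c a a')
      (fun c _ a ha a' ha' hne => (hminR c a ha a' ha' hne).imp hswap hswap)
    set T1 := (Bs ×ˢ (As ∪ Cs).offDiag).filter fun p => R p.1 p.2.1 p.2.2 with hT1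
    set T2 := (As ×ˢ Cs.offDiag).filter fun p => R p.2.1 p.1 p.2.2 with hT2
    set T3 := (Cs ×ˢ As.offDiag).filter fun p => R p.1 p.2.1 p.2.2 with hT3
    have i1 : (T1.image fun p => ((p.1, p.2.1), p.2.2)).card = T1.card := by
      apply Finset.card_image_of_injective
      rintro ⟨a, b, c⟩ ⟨a', b', c'⟩ h
      simp only [Prod.mk.injEq] at h ⊢
      tauto
    have i2 : (T2.image fun p => ((p.2.1, p.1), p.2.2)).card = T2.card := by
      apply Finset.card_image_of_injective
      rintro ⟨a, b, c⟩ ⟨a', b', c'⟩ h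
      simp only [Prod.mk.injEq] at h ⊢
      tauto
    have i3 : (T3.image fun p => ((p.1, p.2.1), p.2.2)).card = T3.card := by
      apply Finset.card_image_of_injective
      rintro ⟨a, b, c⟩ ⟨a', b', c'⟩ h
      simp only [Prod.mk.injEq] at h ⊢
      tauto
    have t1 : ∀ t ∈ T1.image (fun p => ((p.1, p.2.1), p.2.2)), t.1.1 ∈ Bs ∧ t.1.2 ∈ As ∪ Cs ∧
        t.2 ∈ As ∪ Cs ∧ R t.1.1 t.1.2 t.2 := by
      intro t ht
      obtain ⟨p, hp, rfl⟩ := Finset.mem_image.1 ht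
      simp only [hT1, mem_filter, mem_product, mem_offDiag] at hp
      exact ⟨hp.1.1, hp.1.2.1, hp.1.2.2.1, hp.2⟩
    have t2 : ∀ t ∈ T2.image (fun p => ((p.2.1, p.1), p.2.2)), t.1.1 ∈ Cs ∧ t.1.2 ∈ As ∧
        t.2 ∈ Cs ∧ R t.1.1 t.1.2 t.2 := by
      intro t ht
      obtain ⟨p, hp, rfl⟩ := Finset.mem_image.1 ht
      simp only [hT2, mem_filter, mem_product, mem_offDiag] at hp
      exact ⟨hp.1.2.1, hp.1.1, hp.1.2.2.1, hp.2⟩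
    have t3 : ∀ t ∈ T3.image (fun p => ((p.1, p.2.1), p.2.2)), t.1.1 ∈ Cs ∧ t.1.2 ∈ As ∧
        t.2 ∈ As ∧ R t.1.1 t.1.2 t.2 := by
      intro t ht
      obtain ⟨p, hp, rfl⟩ := Finset.mem_image.1 ht
      simp only [hT3, mem_filter, mem_product, mem_offDiag] at hp
      exact ⟨hp.1.1, hp.1.2.1, hp.1.2.2.1, hp.2⟩
    -- the three families of failures are disjoint; rank: middle, greatest slope, least slope
    have htotal := hC.card_le_sum_card_not_canReach (As ∪ Cs)
      (fun i => if i ∈ Bs then 0 else if i ∈ Cs then 1 else 2)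
      (T1.image (fun p => ((p.1, p.2.1), p.2.2)) ∪
        (T2.image (fun p => ((p.2.1, p.1), p.2.2)) ∪ T3.image (fun p => ((p.1, p.2.1), p.2.2))))
      (by
        have hCB : ∀ i, i ∈ Cs → i ∉ Bs := fun i hi hi' =>
          Finset.disjoint_left.1 hdB hi' (mem_union_right _ hi)
        have hAB : ∀ i, i ∈ As → i ∉ Bs := fun i hi hi' =>
          Finset.disjoint_left.1 hdB hi' (mem_union_left _ hi)
        have hAC : ∀ i, i ∈ As → i ∉ Cs := fun i hi hi' => Finset.disjoint_left.1 hdAC hi hi'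
        intro t ht
        rw [mem_union, mem_union] at ht
        rcases ht with ht | ht | ht
        · obtain ⟨h1, h2, h3, h4⟩ := t1 t ht
          refine ⟨?_, ?_, h3, h4⟩
          · rcases mem_union.1 h2 with h | h
            · simp [h1, hAB _ h, hAC _ h]
            · simp [h1, hCB _ h, h]
          · intro h
            rw [mB] at h1
            rw [mem_union, mA, mC, ← h] at h2
            tauto
        · obtain ⟨h1, h2, h3, h4⟩ := t2 t ht
          refine ⟨by simp [h1, hCB _ h1, hAB _ h2, hAC _ h2], ?_, mem_union_right _ h3, h4⟩
          rw [mC] at h1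
          rw [mA] at h2
          rw [h1, h2]
          exact huv.symm
        · obtain ⟨h1, h2, h3, h4⟩ := t3 t ht
          refine ⟨by simp [h1, hCB _ h1, hAB _ h2, hAC _ h2], ?_, mem_union_left _ h3, h4⟩
          rw [mC] at h1
          rw [mA] at h2
          rw [h1, h2]
          exact huv.symm)
    rw [Finset.card_union_of_disjoint, Finset.card_union_of_disjoint, i1, i2, i3] at htotal
    rotate_left
    · rw [Finset.disjoint_left]
      intro t h h'
      exact Finset.disjoint_left.1 hdAC (t3 t h').2.2.1 (t2 t h).2.2.1
    · rw [Finset.disjoint_left]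
      intro t h h'
      refine Finset.disjoint_left.1 hdB (t1 t h).1 (mem_union_right _ ?_)
      rcases mem_union.1 h' with h' | h'
      · exact (t2 t h').1
      · exact (t3 t h').1
    rw [hE] at c1
    have hsub : ∀ x y : ℕ, ((x * (y * y - y) : ℕ) : ℝ) = (x : ℝ) * ((y : ℝ) * (y - 1)) := by
      intro x y
      rw [Nat.cast_mul, Nat.cast_sub (Nat.le_mul_self y)]
      push_cast
      ring
    have c1' : ((Bs.card * ((As.card + Cs.card) * (As.card + Cs.card) -
        (As.card + Cs.card)) : ℕ) : ℝ) ≤ ((2 * T1.card : ℕ) : ℝ) := by exact_mod_cast c1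
    have c2' : ((As.card * (Cs.card * Cs.card - Cs.card) : ℕ) : ℝ) ≤ ((2 * T2.card : ℕ) : ℝ) := by
      exact_mod_cast c2
    have c3' : ((Cs.card * (As.card * As.card - As.card) : ℕ) : ℝ) ≤ ((2 * T3.card : ℕ) : ℝ) := by
      exact_mod_cast c3
    rw [hsub] at c1' c2' c3'
    have htotal' : ((T1.card : ℝ) + (T2.card + T3.card)) ≤
        ((∑ k, ((As ∪ Cs).filter fun x => ¬ C.CanReach k x).card : ℕ) : ℝ) := by
      exact_mod_cast htotal
    push_cast at c1' c2' c3'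
    rw [hsplit]
    linarith

end LineArrangement

/-! ### Perturbation to general position -/

/-- A nonzero polynomial has no zeros close to `0`, apart from `0` itself. -/
theorem eventually_add_sum_mul_pow_ne_zero {n : ℕ} (c : ℝ) (u : Fin n → ℝ) (i : Fin n)
    (hi : u i ≠ 0) :
    ∀ᶠ δ : ℝ in nhdsWithin 0 (Set.Ioi 0), c + ∑ j, u j * δ ^ ((j : ℕ) + 1) ≠ 0 := by
  classical
  let p : Polynomial ℝ := Polynomial.C c + ∑ j : Fin n, Polynomial.monomial ((j : ℕ) + 1) (u j)
  have hp : p ≠ 0 := by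
    intro h
    apply hi
    have h1 : p.coeff ((i : ℕ) + 1) = u i := by
      simp only [p, Polynomial.coeff_add, Polynomial.coeff_C_succ, Polynomial.finsetSum_coeff,
        Polynomial.coeff_monomial, zero_add, add_left_inj]
      rw [Finset.sum_eq_single i]
      · simp
      · intro j _ hj
        exact if_neg fun h => hj (Fin.ext h)
      · simp
    rw [← h1, h, Polynomial.coeff_zero]
  have hfin : {δ : ℝ | p.eval δ = 0}.Finite := by
    refine (p.roots.toFinset.finite_toSet).subset fun δ hδ => ?_
    simpa [hp] using hδ
  have h1 : ∀ᶠ δ : ℝ in nhdsWithin 0 (Set.Ioi 0), δ ∈ ({δ : ℝ | p.eval δ = 0} \ {0})ᶜ := by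
    apply Filter.Eventually.filter_mono nhdsWithin_le_nhds
    exact (hfin.subset Set.sdiff_subset).isClosed.isOpen_compl.mem_nhds (by simp)
  filter_upwards [h1, self_mem_nhdsWithin] with δ hδ hpos h
  apply hδ
  refine ⟨?_, (ne_of_gt hpos : δ ≠ 0)⟩
  show p.eval δ = 0
  simpa [p, Polynomial.eval_finsetSum] using h

namespace LineArrangement

/-- A small perturbation of the intercepts makes an arrangement generic and preserves all strict
inequalities between the meeting times along each line. -/
theorem exists_generic {n : ℕ} (s β : Fin n → ℝ) :
    ∃ A : LineArrangement n, A.slope = s ∧ A.Generic ∧ ∀ i j l, s i ≠ s j → s i ≠ s l →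
      (β j - β i) / (s i - s j) < (β l - β i) / (s i - s l) → A.meetTime i j < A.meetTime i l := by
  classical
  let b : ℝ → Fin n → ℝ := fun δ i => β i + δ ^ ((i : ℕ) + 1)
  have hdist : ∀ᶠ δ : ℝ in nhdsWithin 0 (Set.Ioi 0), ∀ i j : Fin n, i ≠ j → b δ i ≠ b δ j := by
    rw [Filter.eventually_all]
    intro i
    rw [Filter.eventually_all]
    intro j
    by_cases hij : i = j
    · simp [hij]
    have := eventually_add_sum_mul_pow_ne_zero (β i - β j)
      (fun x => Pi.single (M := fun _ => ℝ) i 1 x - Pi.single (M := fun _ => ℝ) j 1 x) i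
      (by simp [hij])
    filter_upwards [this] with δ hδ _ h
    apply hδ
    simp only [sub_mul, Finset.sum_sub_distrib, Pi.single_apply, ite_mul, one_mul, zero_mul,
      Finset.sum_ite_eq', mem_univ, if_true]
    simp only [b] at h
    linarith
  have hgen : ∀ᶠ δ : ℝ in nhdsWithin 0 (Set.Ioi 0), ∀ i j k l : Fin n, s i ≠ s j → s k ≠ s l →
      i ≠ k → i ≠ l →
      (b δ j - b δ i) * (s k - s l) - (b δ l - b δ k) * (s i - s j) ≠ 0 := by
    simp only [Filter.eventually_all]
    intro i j k l hij hkl hik hil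
    have hij' : i ≠ j := fun h => hij (by rw [h])
    have := eventually_add_sum_mul_pow_ne_zero
      ((β j - β i) * (s k - s l) - (β l - β k) * (s i - s j))
      (fun x => (Pi.single (M := fun _ => ℝ) j 1 x - Pi.single (M := fun _ => ℝ) i 1 x)
        * (s k - s l) - (Pi.single (M := fun _ => ℝ) l 1 x - Pi.single (M := fun _ => ℝ) k 1 x)
        * (s i - s j)) i
      (by
        simp only [Pi.single_apply, hij', hik, hil, if_false, if_true]
        simpa using sub_ne_zero.2 hkl.symm)
    filter_upwards [this] with δ hδ h
    apply hδ
    simp only [sub_mul, Finset.sum_sub_distrib, Pi.single_apply, ite_mul, one_mul,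
      zero_mul, Finset.sum_ite_eq', mem_univ, if_true]
    simp only [b] at h
    linarith
  have hord : ∀ᶠ δ : ℝ in nhdsWithin 0 (Set.Ioi 0), ∀ i j l, s i ≠ s j → s i ≠ s l →
      (β j - β i) / (s i - s j) < (β l - β i) / (s i - s l) →
      (b δ j - b δ i) / (s i - s j) < (b δ l - b δ i) / (s i - s l) := by
    simp only [Filter.eventually_all]
    intro i j l hij hil hlt
    apply Filter.Eventually.filter_mono nhdsWithin_le_nhds
    have hcont : ∀ x y : Fin n, Continuous fun δ => (b δ y - b δ x) / (s x - s y) := by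
      intro x y
      simp only [b]
      fun_prop
    apply (hcont i j).continuousAt.eventually_lt (hcont i l).continuousAt
    simpa [b] using hlt
  obtain ⟨δ, ⟨hδ1, hδ2⟩, hδ3⟩ := ((hdist.and hgen).and hord).exists
  let A : LineArrangement n := ⟨s, b δ, fun i j h => by
    by_contra hij
    exact hδ1 i j hij (Prod.mk.inj h).2⟩
  refine ⟨A, rfl, ?_, fun i j l hij hil h => hδ3 i j l hij hil h⟩
  -- if the pairs differ then the first one has a line that the second one lacks
  have key : ∀ i j k l x, A.MeetAt i j x → A.MeetAt k l x → i ≠ k → i ≠ l → False := by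
    intro i j k l x h h' hik hil
    rw [meetAt_iff] at h h'
    apply hδ2 i j k l h.1 h'.1 hik hil
    have h1 : (b δ j - b δ i) / (s i - s j) = (b δ l - b δ k) / (s k - s l) := h.2.symm.trans h'.2
    rw [div_eq_div_iff (sub_ne_zero.2 h.1) (sub_ne_zero.2 h'.1)] at h1
    linarith
  intro i j k l x h h'
  have hi : i = k ∨ i = l := by
    by_contra hne
    push Not at hne
    exact key i j k l x h h' hne.1 hne.2
  have hj : j = k ∨ j = l := by
    by_contra hne
    push Not at hne
    exact key j i k l x ⟨h.1.symm, h.2.symm⟩ h' hne.1 hne.2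
  apply Finset.eq_of_subset_of_card_le
  · intro y hy
    simp only [mem_insert, mem_singleton] at hy ⊢
    rcases hy with rfl | rfl <;> assumption
  · rw [Finset.card_pair h.1, Finset.card_pair h'.1]

end LineArrangement

/-! ### The sweeping arrangement: who reaches whom -/

namespace Sweep

/-- Index set of the lines of the construction: `m` middle lines and `2 * h` extreme lines, those
of greatest slope carrying the flag `true` and those of least slope the flag `false`. -/
abbrev Idx (m h : ℕ) : Type := Fin m ⊕ (Fin h × Bool)

variable {m h : ℕ}

/-- The slope of an extreme line. -/
def sgn (b : Bool) : ℝ := if b then 1 else -1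

/-- The extreme lines sweep over the middle lines one after the other, with alternating signs of
the slope; this is the position of an extreme line in that order. -/
def rank (e : Fin h × Bool) : ℕ := 2 * (e.1 : ℕ) + (if e.2 then 0 else 1)

/-- Slopes: the middle lines form blocks of `q` parallel lines, of small slopes. -/
noncomputable def slope (ε : ℝ) (q : ℕ) : Idx m h → ℝ :=
  Sum.elim (fun i => ε * (((i : ℕ) / q : ℕ) : ℝ)) (fun e => sgn e.2)

/-- Intercepts: the middle lines run close to the first axis, and the extreme line `e` crosses that
axis at `rank e + 1`. -/
noncomputable def intercept (ε : ℝ) : Idx m h → ℝ :=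
  Sum.elim (fun i => ε * ((i : ℕ) : ℝ)) (fun e => -(sgn e.2) * ((rank e : ℝ) + 1))

/-- The first coordinate of the intersection of two lines before perturbation. -/
noncomputable def time (ε : ℝ) (q : ℕ) (x y : Idx m h) : ℝ :=
  (intercept ε y - intercept ε x) / (slope ε q x - slope ε q y)

theorem time_comm (ε : ℝ) (q : ℕ) (x y : Idx m h) : time ε q x y = time ε q y x := by
  unfold time
  rw [← neg_sub, ← neg_sub (slope ε q y), neg_div_neg_eq]

theorem rank_lt (e : Fin h × Bool) : rank e < 2 * h := by
  have := e.1.2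
  unfold rank
  split_ifs <;> omega

theorem rank_injective : Function.Injective (rank : Fin h × Bool → ℕ) := by
  rintro ⟨p, b⟩ ⟨p', b'⟩ h
  unfold rank at h
  rcases b <;> rcases b' <;> simp at h ⊢ <;> omega

theorem slope_true_ne_false (ε : ℝ) (q : ℕ) (p p' : Fin h) :
    slope ε q (Sum.inr (p, true) : Idx m h) ≠ slope ε q (Sum.inr (p', false) : Idx m h) := by
  simp only [slope, Sum.elim_inr, sgn]
  norm_num

theorem time_true_false (ε : ℝ) (q : ℕ) (p p' : Fin h) :
    time ε q (Sum.inr (p, true) : Idx m h) (Sum.inr (p', false)) = (p : ℕ) + (p' : ℕ) + 3 / 2 := by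
  simp only [time, slope, intercept, Sum.elim_inr, sgn, rank]
  norm_num
  ring

theorem time_middle_true (ε : ℝ) (q : ℕ) (i : Fin m) (p : Fin h) :
    time ε q (Sum.inr (p, true) : Idx m h) (Sum.inl i) =
      ((rank (p, true) : ℝ) + 1 + ε * ((i : ℕ) : ℝ)) / (1 - ε * (((i : ℕ) / q : ℕ) : ℝ)) := by
  simp only [time, slope, intercept, Sum.elim_inl, Sum.elim_inr, sgn]
  norm_num
  ring_nf

theorem time_middle_false (ε : ℝ) (q : ℕ) (i : Fin m) (p : Fin h) :
    time ε q (Sum.inr (p, false) : Idx m h) (Sum.inl i) =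
      ((rank (p, false) : ℝ) + 1 - ε * ((i : ℕ) : ℝ)) / (1 + ε * (((i : ℕ) / q : ℕ) : ℝ)) := by
  simp only [time, slope, intercept, Sum.elim_inl, Sum.elim_inr, sgn]
  norm_num
  rw [← neg_div_neg_eq]
  ring_nf

/-- Both slopes and intercepts of the middle lines increase with the index. -/
theorem time_middle_nonpos {ε : ℝ} (hε : 0 < ε) (q : ℕ) {i j : Fin m}
    (hij : slope ε q (Sum.inl i : Idx m h) ≠ slope ε q (Sum.inl j : Idx m h)) :
    time ε q (Sum.inl i : Idx m h) (Sum.inl j) ≤ 0 := by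
  wlog hlt : i < j generalizing i j
  · rw [time_comm]
    refine this hij.symm (lt_of_le_of_ne (not_lt.1 hlt) ?_)
    rintro rfl
    exact hij rfl
  simp only [time, slope, intercept, Sum.elim_inl]
  have h2 : ((i : ℕ) : ℝ) < (j : ℕ) := by exact_mod_cast hlt
  have h3 : (((i : ℕ) / q : ℕ) : ℝ) ≤ (((j : ℕ) / q : ℕ) : ℝ) := by
    exact_mod_cast Nat.div_le_div_right (Fin.le_def.1 hlt.le)
  have h4 := mul_le_mul_of_nonneg_left h3 hε.le
  have h5 := mul_lt_mul_of_pos_left h2 hε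
  apply div_nonpos_of_nonneg_of_nonpos <;> linarith

section bounds

variable {ε : ℝ} (hε : 0 < ε) (hε' : ε * (m + m * (2 * h + 1)) < 1 / 2) (q : ℕ)
include hε hε'

/-- The choice of `ε`: up to the time of the sweep by `e` the middle lines stay within `1 / 2` of
the first axis. -/
theorem small (i : Fin m) (e : Fin h × Bool) :
    ε * ((i : ℕ) : ℝ) + ε * (((i : ℕ) / q : ℕ) : ℝ) * ((rank e : ℝ) + 3 / 2) < 1 / 2 := by
  have h1 : ((i : ℕ) : ℝ) ≤ m - 1 := by
    have : (i : ℕ) + 1 ≤ m := i.2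
    have : (((i : ℕ) + 1 : ℕ) : ℝ) ≤ m := by exact_mod_cast this
    push_cast at this
    linarith
  have h2 : (((i : ℕ) / q : ℕ) : ℝ) ≤ m := by
    have : (i : ℕ) / q ≤ m := (Nat.div_le_self _ _).trans i.2.le
    exact_mod_cast this
  have h3 : (rank e : ℝ) + 1 ≤ 2 * h := by
    have := rank_lt e
    exact_mod_cast this
  have h4 : (0 : ℝ) ≤ (((i : ℕ) / q : ℕ) : ℝ) := by positivity
  have h5 : (((i : ℕ) / q : ℕ) : ℝ) * ((rank e : ℝ) + 3 / 2) ≤ m * (2 * h + 1) := by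
    apply mul_le_mul h2 (by linarith) (by positivity) (by positivity)
  have h6 := mul_le_mul_of_nonneg_left (add_le_add h1 h5) hε.le
  nlinarith

theorem slope_middle_lt_one (i : Fin m) (hh : 0 < h) : ε * (((i : ℕ) / q : ℕ) : ℝ) < 1 := by
  have := small hε hε' q i ((⟨0, hh⟩, true) : Fin h × Bool)
  simp only [rank] at this
  have h1 : 0 ≤ ε * ((i : ℕ) : ℝ) := by positivity
  have h2 : 0 ≤ ε * (((i : ℕ) / q : ℕ) : ℝ) := by positivity
  norm_num at this
  nlinarith

theorem slope_ne (i : Fin m) (e : Fin h × Bool) :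
    slope ε q (Sum.inl i : Idx m h) ≠ slope ε q (Sum.inr e : Idx m h) := by
  have h1 := slope_middle_lt_one hε hε' q i (Nat.zero_lt_of_lt e.1.2)
  have h2 : 0 ≤ ε * (((i : ℕ) / q : ℕ) : ℝ) := by positivity
  rcases e with ⟨p, _ | _⟩
  · simp only [slope, Sum.elim_inl, Sum.elim_inr, sgn]
    norm_num
    linarith
  · simp only [slope, Sum.elim_inl, Sum.elim_inr, sgn]
    norm_num
    linarith

/-- The extreme line `e` sweeps over the middle lines within `1 / 2` of the time `rank e + 1`. -/
theorem time_mem (i : Fin m) (e : Fin h × Bool) :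
    (rank e : ℝ) + 1 / 2 < time ε q (Sum.inl i : Idx m h) (Sum.inr e) ∧
      time ε q (Sum.inl i : Idx m h) (Sum.inr e) < (rank e : ℝ) + 3 / 2 := by
  have h1 := slope_middle_lt_one hε hε' q i (Nat.zero_lt_of_lt e.1.2)
  have h2 : 0 ≤ ε * (((i : ℕ) / q : ℕ) : ℝ) := by positivity
  have h3 := small hε hε' q i e
  have h4 : 0 ≤ ε * ((i : ℕ) : ℝ) := by positivity
  have h5 : (0 : ℝ) ≤ rank e := by positivity
  rw [time_comm]
  rcases e with ⟨p, _ | _⟩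
  · rw [time_middle_false, lt_div_iff₀ (by linarith), div_lt_iff₀ (by linarith)]
    constructor <;> nlinarith
  · rw [time_middle_true, lt_div_iff₀ (by linarith), div_lt_iff₀ (by linarith)]
    constructor <;> nlinarith

theorem time_lt_of_rank_lt (i : Fin m) {e e' : Fin h × Bool} (hee : rank e < rank e') :
    time ε q (Sum.inl i : Idx m h) (Sum.inr e) < time ε q (Sum.inl i) (Sum.inr e') := by
  have h1 : (rank e : ℝ) + 1 ≤ rank e' := by exact_mod_cast hee
  have h2 := (time_mem hε hε' q i e).2
  have h3 := (time_mem hε hε' q i e').1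
  linarith

/-- After time `0` the middle lines are ordered by their indices, from the bottom to the top, so
that an ascending line meets them in this order. -/
theorem time_true_lt {i j : Fin m} (hij : i < j) (p : Fin h) :
    time ε q (Sum.inr (p, true) : Idx m h) (Sum.inl i) <
      time ε q (Sum.inr (p, true)) (Sum.inl j) := by
  have h1 := slope_middle_lt_one hε hε' q j (Nat.zero_lt_of_lt p.2)
  have h2 : ((i : ℕ) : ℝ) < (j : ℕ) := by exact_mod_cast hij
  have h3 : (((i : ℕ) / q : ℕ) : ℝ) ≤ (((j : ℕ) / q : ℕ) : ℝ) := by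
    exact_mod_cast Nat.div_le_div_right (Fin.le_def.1 hij.le)
  have h4 := mul_le_mul_of_nonneg_left h3 hε.le
  have h5 := mul_lt_mul_of_pos_left h2 hε
  rw [time_middle_true, time_middle_true]
  apply div_lt_div₀ <;> first | linarith | positivity

/-- A descending line meets the middle lines in the opposite order. -/
theorem time_false_lt {i j : Fin m} (hij : i < j) (p : Fin h) :
    time ε q (Sum.inr (p, false) : Idx m h) (Sum.inl j) <
      time ε q (Sum.inr (p, false)) (Sum.inl i) := by
  have h1 : 0 ≤ ε * (((i : ℕ) / q : ℕ) : ℝ) := by positivity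
  have h2 : ((i : ℕ) : ℝ) < (j : ℕ) := by exact_mod_cast hij
  have h3 : (((i : ℕ) / q : ℕ) : ℝ) ≤ (((j : ℕ) / q : ℕ) : ℝ) := by
    exact_mod_cast Nat.div_le_div_right (Fin.le_def.1 hij.le)
  have h4 := mul_le_mul_of_nonneg_left h3 hε.le
  have h5 := mul_lt_mul_of_pos_left h2 hε
  have h6 := small hε hε' q i (p, false)
  have h7 : (0 : ℝ) ≤ rank (p, false) := by positivity
  have h8 : 0 ≤ ε * (((i : ℕ) / q : ℕ) : ℝ) * ((rank (p, false) : ℝ) + 3 / 2) := by positivity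
  rw [time_middle_false, time_middle_false]
  apply div_lt_div₀ <;> linarith

variable {R : Idx m h → Idx m h → Idx m h → Prop}
  (hleft : ∀ {x y}, slope ε q x ≠ slope ε q y → R x y x)
  (hcomm : ∀ {x y z}, R x y z → R y x z)
  (hhop : ∀ {x y z w}, slope ε q x ≠ slope ε q y → slope ε q x ≠ slope ε q z →
    time ε q x y < time ε q x z → R x z w → R x y w)
include hleft hcomm hhop

/-- The intersection of a middle line with an extreme line reaches all extreme lines that sweep
later, and all middle lines unless the extreme line is the very last one. -/
theorem reach_middle_extreme (i : Fin m) (e : Fin h × Bool) (w : Idx m h)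
    (h1 : ∀ e', w = Sum.inr e' → rank e ≤ rank e')
    (h2 : ∀ j, w = Sum.inl j → i < j → rank e + 1 < 2 * h) :
    R (Sum.inl i) (Sum.inr e) w := by
  have hne := fun i e => slope_ne (h := h) hε hε' q i e
  have hright : ∀ {x y}, slope ε q x ≠ slope ε q y → R x y y := fun h => hcomm (hleft h.symm)
  have hup : ∀ (i j : Fin m) (p : Fin h), i < j → R (Sum.inl i) (Sum.inr (p, true)) (Sum.inl j) :=
    fun i j p hij => hcomm (hhop (hne _ _).symm (hne _ _).symm (time_true_lt hε hε' q hij p)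
      (hright (hne _ _).symm))
  have hdown : ∀ (i j : Fin m) (p : Fin h), j < i →
      R (Sum.inl i) (Sum.inr (p, false)) (Sum.inl j) :=
    fun i j p hij => hcomm (hhop (hne _ _).symm (hne _ _).symm (time_false_lt hε hε' q hij p)
      (hright (hne _ _).symm))
  rcases w with j | e'
  · rcases lt_trichotomy i j with hij | rfl | hij
    · rcases e with ⟨p, _ | _⟩
      ·
        have h3 := h2 j rfl hij
        simp only [rank] at h3
        have hp : (p : ℕ) + 1 < h := by
          norm_num at h3
          omega
        refine hhop (hne _ _) (hne _ _) (time_lt_of_rank_lt hε hε' q i ?_)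
          (hup i j ⟨(p : ℕ) + 1, hp⟩ hij)
        simp only [rank]
        norm_num
        omega
      · exact hup i j p hij
    · exact hleft (hne _ _)
    · rcases e with ⟨p, _ | _⟩
      · exact hdown i j p hij
      · refine hhop (hne _ _) (hne _ _) (time_lt_of_rank_lt hε hε' q i ?_) (hdown i j p hij)
        simp [rank]
  · rcases eq_or_lt_of_le (h1 e' rfl) with h3 | h3
    · rw [rank_injective h3]
      exact hright (hne _ _)
    · exact hhop (hne _ _) (hne _ _) (time_lt_of_rank_lt hε hε' q i h3) (hright (hne _ _))

/-- The intersections of middle lines precede all others and reach everything. -/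
theorem reach_middle_middle (hh : 0 < h) {i j : Fin m}
    (hij : slope ε q (Sum.inl i : Idx m h) ≠ slope ε q (Sum.inl j : Idx m h)) (w : Idx m h) :
    R (Sum.inl i) (Sum.inl j) w := by
  have hto : ∀ e, R (Sum.inl i) (Sum.inr e) w → R (Sum.inl i) (Sum.inl j) w := by
    intro e
    apply hhop hij (slope_ne hε hε' q i e)
    have h1 := time_middle_nonpos hε q hij
    have h2 := (time_mem hε hε' q i e).1
    have h3 : (0 : ℝ) ≤ rank e := by positivity
    linarith
  rcases w with l | e
  · apply hto (⟨0, hh⟩, true)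
    apply reach_middle_extreme hε hε' q hleft hcomm hhop
    · intro e' he'
      cases he'
    · intro _ _ _
      simp only [rank]
      norm_num
      omega
  · apply hto e
    apply reach_middle_extreme hε hε' q hleft hcomm hhop
    · intro e' he'
      rw [Sum.inr.inj he']
    · intro _ h
      cases h

/-- The intersection of two extreme lines reaches all middle lines, and every extreme line that
runs behind the parallel one of the two. -/
theorem reach_extreme_extreme (p p' : Fin h) (w : Idx m h)
    (h1 : ∀ l b, w = Sum.inr (l, b) → (if b then p else p') ≤ l) :
    R (Sum.inr (p, true)) (Sum.inr (p', false)) w := by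
  have hne := fun p p' => slope_true_ne_false (m := m) (h := h) ε q p p'
  have hright : ∀ {x y}, slope ε q x ≠ slope ε q y → R x y y := fun h => hcomm (hleft h.symm)
  have hcast : ∀ l l' : Fin h, l < l' → ((l : ℕ) : ℝ) < (l' : ℕ) := fun l l' h => by
    exact_mod_cast h
  rcases w with j | ⟨l, _ | _⟩
  · -- the one of the two lines that sweeps later still has all middle lines ahead
    by_cases hpp : p ≤ p'
    · apply hcomm
      apply hhop (hne p p').symm (slope_ne hε hε' q j (p', false)).symm _
        (hright (slope_ne hε hε' q j (p', false)).symm)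
      rw [time_comm, time_true_false, time_comm]
      have h2 := (time_mem hε hε' q j (p', false)).1
      have h3 : ((p : ℕ) : ℝ) ≤ (p' : ℕ) := by exact_mod_cast hpp
      simp only [rank] at h2
      norm_num at h2
      linarith
    · apply hhop (hne p p') (slope_ne hε hε' q j (p, true)).symm _
        (hright (slope_ne hε hε' q j (p, true)).symm)
      rw [time_true_false, time_comm]
      have h2 := (time_mem hε hε' q j (p, true)).1
      have h3 : ((p' : ℕ) : ℝ) + 1 ≤ (p : ℕ) := by exact_mod_cast not_le.1 hpp
      simp only [rank] at h2
      norm_num at h2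
      linarith
  · have h2 := h1 l false rfl
    simp only [Bool.false_eq_true, if_false] at h2
    rcases eq_or_lt_of_le h2 with rfl | h3
    · exact hright (hne _ _)
    · apply hhop (hne p p') (hne p l) _ (hright (hne _ _))
      rw [time_true_false, time_true_false]
      linarith [hcast _ _ h3]
  · have h2 := h1 l true rfl
    simp only [if_true] at h2
    rcases eq_or_lt_of_le h2 with rfl | h3
    · exact hleft (hne _ _)
    · apply hcomm
      apply hhop (hne p p').symm (hne l p').symm _ (hright (hne _ _).symm)
      rw [time_comm, time_true_false, time_comm, time_true_false]
      linarith [hcast _ _ h3]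

end bounds

end Sweep

/-! ### The sweeping arrangement: counting failed deliveries -/

namespace LineArrangement.Generates

variable {n : ℕ} {A : LineArrangement n} {C : CMSN n} (hC : A.Generates C)
include hC

theorem reach_left {i j : Fin n} (h : A.slope i ≠ A.slope j) :
    ∃ k, C.packet k = {i, j} ∧ C.CanReach k i := by
  obtain ⟨k, hk⟩ := hC.exists_index h
  exact ⟨k, hk, k, Relation.ReflTransGen.refl, by rw [hk]; simp⟩

/-- A packet reaches whatever a later packet on the line `i` reaches. -/
theorem reach_of_hop {i j l x : Fin n} (h : A.slope i ≠ A.slope j)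
    (ht : A.meetTime i j < A.meetTime i l) (hr : ∃ k, C.packet k = {i, l} ∧ C.CanReach k x) :
    ∃ k, C.packet k = {i, j} ∧ C.CanReach k x := by
  obtain ⟨k, hk⟩ := hC.exists_index h
  obtain ⟨k', hk', l', hl', hx⟩ := hr
  refine ⟨k, hk, l', Relation.ReflTransGen.head ⟨hC.lt_of_meetTime_lt hk hk' ht, i, ?_⟩ hl', hx⟩
  rw [mem_inter, hk, hk']
  simp

end LineArrangement.Generates

namespace Sweep

variable {m h : ℕ}

theorem two_mul_sum_fin (N : ℕ) : 2 * ∑ i : Fin N, (i : ℕ) = N * (N - 1) := by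
  rw [Fin.sum_univ_eq_sum_range (fun i => i), mul_comm, Finset.sum_range_id_mul_two]

theorem sum_rank (h : ℕ) : ∑ e : Fin h × Bool, rank e + h = 2 * h * h := by
  rw [Fintype.sum_prod_type]
  simp only [Fintype.univ_bool, rank, mem_singleton, Bool.true_eq_false, not_false_eq_true,
    sum_insert, sum_singleton, if_true, Bool.false_eq_true, if_false]
  have h1 := two_mul_sum_fin h
  have h2 : ∑ x : Fin h, (2 * (x : ℕ) + 0 + (2 * (x : ℕ) + 1)) =
      2 * (2 * ∑ x : Fin h, (x : ℕ)) + h := by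
    rw [Finset.sum_congr rfl (g := fun x : Fin h => 4 * (x : ℕ) + 1) (fun x _ => by ring),
      Finset.sum_add_distrib, ← Finset.mul_sum]
    simp
    ring
  rw [h2, h1]
  rcases h with _ | h
  · simp
  · simp only [Nat.add_sub_cancel]
    ring

theorem card_rank_lt_le (e : Fin h × Bool) :
    (univ.filter fun e' : Fin h × Bool => rank e' < rank e).card ≤ rank e := by
  rw [← Finset.card_image_of_injective _ (rank_injective (h := h))]
  refine le_trans (Finset.card_le_card (t := Finset.range (rank e)) ?_) (by simp)
  intro x hx
  obtain ⟨e', he', rfl⟩ := Finset.mem_image.1 hx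
  simpa using he'

theorem card_div_eq_le {q : ℕ} (hq : 0 < q) (i : Fin m) :
    (univ.filter fun j : Fin m => (j : ℕ) / q = (i : ℕ) / q).card ≤ q := by
  rw [← Finset.card_image_of_injective _ Fin.val_injective]
  refine le_trans (Finset.card_le_card
    (t := Finset.Ico (q * ((i : ℕ) / q)) (q * ((i : ℕ) / q) + q)) ?_) (by simp)
  intro x hx
  obtain ⟨j, hj, rfl⟩ := Finset.mem_image.1 hx
  simp only [mem_filter, mem_univ, true_and] at hj
  rw [mem_Ico, ← hj]
  have h1 := Nat.div_add_mod (j : ℕ) q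
  have h2 := Nat.mod_lt (j : ℕ) hq
  omega

/-- The number of ordered pairs of parallel lines. -/
theorem card_parallel_le {ε : ℝ} (hε : 0 < ε) (hε' : ε * (m + m * (2 * h + 1)) < 1 / 2) {q : ℕ}
    (hq : 0 < q) :
    (univ.filter fun p : Idx m h × Idx m h => slope ε q p.1 = slope ε q p.2).card ≤
      m * q + 2 * h * h := by
  classical
  have h0 : (univ.filter fun p : Idx m h × Idx m h => slope ε q p.1 = slope ε q p.2).card =
      ∑ x : Idx m h, (univ.filter fun y : Idx m h => slope ε q x = slope ε q y).card := by
    rw [Finset.card_filter, Fintype.sum_prod_type]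
    simp only [Finset.card_filter]
  rw [h0, Fintype.sum_sum_type]
  have h1 : ∀ i : Fin m, (univ.filter fun y : Idx m h =>
      slope ε q (Sum.inl i : Idx m h) = slope ε q y).card ≤ q := by
    intro i
    refine le_trans ?_ (card_div_eq_le hq i)
    rw [← Finset.card_image_of_injective (univ.filter fun j : Fin m => (j : ℕ) / q = (i : ℕ) / q)
      (Sum.inl_injective (β := Fin h × Bool))]
    apply Finset.card_le_card
    rintro (j | e) hy
    · rw [mem_filter] at hy
      have h2 := hy.2
      simp only [slope, Sum.elim_inl] at h2
      apply Finset.mem_image_of_mem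
      rw [mem_filter]
      refine ⟨mem_univ _, ?_⟩
      exact_mod_cast (mul_left_cancel₀ hε.ne' h2).symm
    · rw [mem_filter] at hy
      exact absurd hy.2 (slope_ne hε hε' q i e)
  have h2 : ∀ e : Fin h × Bool, (univ.filter fun y : Idx m h =>
      slope ε q (Sum.inr e : Idx m h) = slope ε q y).card ≤ h := by
    intro e
    have : (univ.image fun p : Fin h => (Sum.inr (p, e.2) : Idx m h)).card ≤ h := by
      simpa using Finset.card_image_le (s := (univ : Finset (Fin h)))
        (f := fun p : Fin h => (Sum.inr (p, e.2) : Idx m h))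
    refine le_trans (Finset.card_le_card ?_) this
    rintro (j | ⟨p, b⟩) hy
    · rw [mem_filter] at hy
      exact absurd hy.2.symm (slope_ne hε hε' q j e)
    · rw [mem_filter] at hy
      have h2 := hy.2
      refine Finset.mem_image.2 ⟨p, mem_univ _, ?_⟩
      rcases e with ⟨p', b'⟩
      simp only [slope, Sum.elim_inr, sgn] at h2
      rcases b <;> rcases b' <;> first | rfl | norm_num at h2
  calc _ ≤ ∑ _i : Fin m, q + ∑ _e : Fin h × Bool, h :=
        add_le_add (Finset.sum_le_sum fun i _ => h1 i) (Finset.sum_le_sum fun e _ => h2 e)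
    _ = m * q + 2 * h * h := by
        simp only [Finset.sum_const, Finset.card_univ, Fintype.card_fin, Fintype.card_prod,
          Fintype.card_bool, smul_eq_mul]
        ring

theorem card_slopes_le (ε : ℝ) {q r : ℕ} (hm : m ≤ q * r) :
    (Set.range (slope ε q : Idx m h → ℝ)).ncard ≤ r + 2 := by
  classical
  have hsub : Set.range (slope ε q : Idx m h → ℝ) ⊆
      (((Finset.range r).image fun j : ℕ => ε * (j : ℝ)) ∪ {1, -1} : Finset ℝ) := by
    rintro x ⟨i | ⟨p, b⟩, rfl⟩
    · rw [Finset.mem_coe, mem_union]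
      left
      refine Finset.mem_image.2 ⟨(i : ℕ) / q, ?_, rfl⟩
      rw [Finset.mem_range, Nat.div_lt_iff_lt_mul]
      · rw [mul_comm]
        exact lt_of_lt_of_le i.2 hm
      · rcases Nat.eq_zero_or_pos q with rfl | hq
        · have := i.2
          simp at hm
          omega
        · exact hq
    · rw [Finset.mem_coe, mem_union]
      right
      simp only [slope, Sum.elim_inr, sgn]
      rcases b <;> simp
  refine (Set.ncard_le_ncard hsub (Finset.finite_toSet _)).trans ?_
  rw [Set.ncard_coe_finset]
  refine (Finset.card_union_le _ _).trans ?_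
  have h1 := Finset.card_image_le (s := Finset.range r) (f := fun j : ℕ => ε * (j : ℝ))
  have h2 := Finset.card_le_two (a := (1 : ℝ)) (b := -1)
  rw [Finset.card_range] at h1
  omega

open Classical in
/-- The failed deliveries of the construction. -/
theorem two_mul_lost_le {n : ℕ} {A : LineArrangement n} {C : CMSN n} (hC : A.Generates C)
    (hh : 0 < h) (e : Idx m h ≃ Fin n) {ε : ℝ} (hε : 0 < ε)
    (hε' : ε * (m + m * (2 * h + 1)) < 1 / 2) (q : ℕ)
    (hs : ∀ x, A.slope (e x) = slope ε q x)
    (ht : ∀ x y z, slope ε q x ≠ slope ε q y → slope ε q x ≠ slope ε q z →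
      time ε q x y < time ε q x z → A.meetTime (e x) (e y) < A.meetTime (e x) (e z)) :
    2 * C.lost + 2 * (m * h) + 2 * (h * h) ≤
      m * (m - 1) + 4 * (m * (h * h)) + 2 * (h * (h * h)) := by
  let R : Idx m h → Idx m h → Idx m h → Prop := fun x y w =>
    ∃ k, C.packet k = {e x, e y} ∧ C.CanReach k (e w)
  have hleft : ∀ {x y}, slope ε q x ≠ slope ε q y → R x y x := fun {x y} hxy =>
    hC.reach_left (by rwa [hs, hs])
  have hcomm : ∀ {x y z}, R x y z → R y x z := by
    rintro x y z ⟨k, hk, hr⟩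
    exact ⟨k, by rw [hk, Finset.pair_comm], hr⟩
  have hhop : ∀ {x y z w}, slope ε q x ≠ slope ε q y → slope ε q x ≠ slope ε q z →
      time ε q x y < time ε q x z → R x z w → R x y w := fun {x y z w} hxy hxz hlt hr =>
    hC.reach_of_hop (by rwa [hs, hs]) (ht _ _ _ hxy hxz hlt) hr
  have hBE := fun i e' w => reach_middle_extreme hε hε' q hleft hcomm hhop i e' w
  have hBB := fun i j hij w =>
    reach_middle_middle hε hε' q hleft hcomm hhop hh (i := i) (j := j) hij w
  have hEE := fun p p' w => reach_extreme_extreme hε hε' q hleft hcomm hhop p p' w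
  let g : Fin C.len → ℕ := fun k => (univ.filter fun x : Fin n => ¬ C.CanReach k x).card
  have hg : ∀ k x y, C.packet k = {e x, e y} → ∀ S : Finset (Idx m h),
      (∀ w, w ∉ S → R x y w) → g k ≤ S.card := by
    intro k x y hk S hS
    rw [← Finset.card_map e.toEmbedding]
    apply Finset.card_le_card
    intro z hz
    rw [mem_filter] at hz
    rw [Finset.mem_map_equiv]
    by_contra hnot
    obtain ⟨k', hk', hr⟩ := hS _ hnot
    rw [Equiv.apply_symm_apply, hC.packet_injective (hk'.trans hk.symm)] at hr
    exact hz.2 hr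
  have hex1 : ∀ (i : Fin m) (d : Fin h × Bool), ∃ k, C.packet k = {e (Sum.inl i), e (Sum.inr d)} :=
    fun i d => hC.exists_index (by rw [hs, hs]; exact slope_ne hε hε' q i d)
  have hex2 : ∀ p p' : Fin h, ∃ k, C.packet k = {e (Sum.inr (p, true)), e (Sum.inr (p', false))} :=
    fun p p' => hC.exists_index (by rw [hs, hs]; exact slope_true_ne_false ε q p p')
  choose k1 hk1 using hex1
  choose k2 hk2 using hex2
  have hg1 : ∀ i d, g (k1 i d) ≤ rank d +
      if d = (⟨h - 1, by omega⟩, false) then (Finset.Ioi i).card else 0 := by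
    intro i d
    refine (hg _ _ _ (hk1 i d) (((univ.filter fun d' => rank d' < rank d).image Sum.inr) ∪
      ((if d = (⟨h - 1, by omega⟩, false) then Finset.Ioi i else ∅).image Sum.inl)) ?_).trans ?_
    · intro w hw
      rw [mem_union, not_or] at hw
      apply hBE
      · rintro d' rfl
        by_contra hlt
        exact hw.1 (Finset.mem_image_of_mem _ (by simpa using hlt))
      · rintro j rfl hij
        by_contra hlt
        apply hw.2
        apply Finset.mem_image_of_mem
        rw [if_pos]
        · exact Finset.mem_Ioi.2 hij
        · apply rank_injective
          have := rank_lt d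
          simp only [rank] at hlt this ⊢
          norm_num at hlt ⊢
          omega
    · refine (Finset.card_union_le _ _).trans (add_le_add ?_ ?_)
      · exact Finset.card_image_le.trans (card_rank_lt_le d)
      · refine Finset.card_image_le.trans ?_
        split_ifs <;> simp
  have hg2 : ∀ p p', g (k2 p p') ≤ (p : ℕ) + (p' : ℕ) := by
    intro p p'
    refine (hg _ _ _ (hk2 p p') (((Finset.Iio p).image fun l => Sum.inr (l, true)) ∪
      ((Finset.Iio p').image fun l => Sum.inr (l, false))) ?_).trans ?_
    · intro w hw
      rw [mem_union, not_or] at hw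
      apply hEE
      rintro l b rfl
      by_contra hlt
      rcases b
      · exact hw.2 (Finset.mem_image.2 ⟨l, by simpa using hlt, rfl⟩)
      · exact hw.1 (Finset.mem_image.2 ⟨l, by simpa using hlt, rfl⟩)
    · refine (Finset.card_union_le _ _).trans (add_le_add ?_ ?_)
      · exact Finset.card_image_le.trans (by simp)
      · exact Finset.card_image_le.trans (by simp)
  have hcov : ∀ k, g k ≠ 0 → (∃ i d, k1 i d = k) ∨ ∃ p p', k2 p p' = k := by
    intro k hk
    obtain ⟨a, b, hab, hp⟩ := hC.exists_pair k
    obtain ⟨x, rfl⟩ := e.surjective a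
    obtain ⟨y, rfl⟩ := e.surjective b
    rw [hs, hs] at hab
    rcases x with i | ⟨p, b⟩ <;> rcases y with j | ⟨p', b'⟩
    · exact absurd (Nat.le_zero.1 (hg k _ _ hp ∅ fun w _ => hBB i j hab w)) hk
    · exact Or.inl ⟨i, (p', b'), hC.packet_injective ((hk1 _ _).trans hp.symm)⟩
    · refine Or.inl ⟨j, (p, b), hC.packet_injective ((hk1 _ _).trans ?_)⟩
      rw [hp, Finset.pair_comm]
    · right
      rcases b <;> rcases b'
      · exact absurd rfl hab
      · refine ⟨p', p, hC.packet_injective ((hk2 _ _).trans ?_)⟩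
        rw [hp, Finset.pair_comm]
      · exact ⟨p, p', hC.packet_injective ((hk2 _ _).trans hp.symm)⟩
      · exact absurd rfl hab
  have hsum : C.lost ≤ ∑ i, ∑ d, g (k1 i d) + ∑ p, ∑ p', g (k2 p p') := by
    -- a packet with failed deliveries is one of the packets `k1`, `k2`
    let kk : (Fin m × (Fin h × Bool)) ⊕ (Fin h × Fin h) → Fin C.len :=
      Sum.elim (fun w => k1 w.1 w.2) (fun w => k2 w.1 w.2)
    have h1 : ∑ i, ∑ d, g (k1 i d) + ∑ p, ∑ p', g (k2 p p') = ∑ w, g (kk w) := by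
      rw [Fintype.sum_sum_type, Fintype.sum_prod_type, Fintype.sum_prod_type]
      rfl
    have h2 : C.lost = ∑ k, g k := rfl
    rw [h1, h2, ← Finset.sum_fiberwise_of_maps_to (s := univ) (t := univ) (g := kk)
      (fun _ _ => mem_univ _)]
    refine Finset.sum_le_sum fun k _ => ?_
    by_cases hk : g k = 0
    · rw [hk]
      exact Nat.zero_le _
    · have hw : ∃ w, kk w = k := by
        rcases hcov k hk with ⟨i, d, hid⟩ | ⟨p, p', hpp⟩
        · exact ⟨Sum.inl (i, d), hid⟩
        · exact ⟨Sum.inr (p, p'), hpp⟩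
      obtain ⟨w, hw⟩ := hw
      calc g k = g (kk w) := by rw [hw]
        _ ≤ _ := Finset.single_le_sum (f := fun w => g (kk w)) (fun _ _ => Nat.zero_le _)
            (by simp [hw])
  have hs1 : ∑ i, ∑ d, g (k1 i d) ≤ m * ∑ d : Fin h × Bool, rank d + ∑ i : Fin m, (i : ℕ) := by
    calc _ ≤ ∑ i : Fin m, (∑ d : Fin h × Bool, rank d + (Finset.Ioi i).card) := by
          refine Finset.sum_le_sum fun i _ => ?_
          refine (Finset.sum_le_sum fun d _ => hg1 i d).trans ?_
          rw [Finset.sum_add_distrib, Finset.sum_ite_eq' univ, if_pos (mem_univ _)]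
      _ = _ := by
          rw [Finset.sum_add_distrib]
          congr 1
          · simp
          · rw [← Equiv.sum_comp Fin.revPerm]
            refine Finset.sum_congr rfl fun i _ => ?_
            rw [Fin.card_Ioi, Fin.revPerm_apply, Fin.val_rev]
            omega
  have hs2 : ∑ p, ∑ p', g (k2 p p') ≤ 2 * (h * ∑ p : Fin h, (p : ℕ)) := by
    calc _ ≤ ∑ p : Fin h, ∑ p' : Fin h, ((p : ℕ) + (p' : ℕ)) :=
          Finset.sum_le_sum fun p _ => Finset.sum_le_sum fun p' _ => hg2 p p'
      _ = _ := by
          simp only [Finset.sum_add_distrib, Finset.sum_const, Finset.card_univ, Fintype.card_fin,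
            smul_eq_mul, ← Finset.mul_sum]
          ring
  have hr := sum_rank h
  have hmm := two_mul_sum_fin m
  have hhh := two_mul_sum_fin h
  have h3 : m * ∑ d : Fin h × Bool, rank d + m * h = m * (2 * h * h) := by
    rw [← Nat.mul_add, hr]
  have h4 : h * (2 * ∑ p : Fin h, (p : ℕ)) + h * h = h * (h * h) := by
    rw [hhh, ← Nat.mul_add]
    congr 1
    rcases h with _ | h
    · simp
    · simp only [Nat.add_sub_cancel]
      ring
  have h5 : h * (2 * ∑ p : Fin h, (p : ℕ)) = 2 * (h * ∑ p : Fin h, (p : ℕ)) := by ring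
  have h6 : m * (2 * h * h) = 2 * (m * (h * h)) := by ring
  rw [h5] at h4
  rw [h6] at h3
  omega

/-- The networks that attain the maximum up to lower-order terms. -/
theorem exists_network (m h q r : ℕ) (hh : 0 < h) (hq : 0 < q) (hm : m ≤ q * r) :
    ∃ C : CMSN (m + 2 * h), IsRGMSN (r + 2) C ∧
      (C.lost : ℝ) ≤ m * (m - 1) / 2 + m * (h * (2 * h - 1)) + h ^ 2 * (h - 1) ∧
      ((m : ℝ) + 2 * h) ^ 2 - m * q - 2 * h ^ 2 ≤ 2 * C.len := by
  classical
  have he : Fintype.card (Idx m h) = m + 2 * h := by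
    simp
    ring
  let e : Idx m h ≃ Fin (m + 2 * h) := Fintype.equivFinOfCardEq he
  obtain ⟨ε, hε, hε'⟩ : ∃ ε : ℝ, 0 < ε ∧ ε * (m + m * (2 * h + 1)) < 1 / 2 := by
    have hK : (0 : ℝ) ≤ m + m * (2 * h + 1) := by positivity
    refine ⟨1 / (2 * (m + m * (2 * h + 1)) + 1), by positivity, ?_⟩
    rw [one_div_mul_eq_div, div_lt_div_iff₀ (by positivity) (by norm_num)]
    linarith
  obtain ⟨A, hAs, hA, hAt⟩ := LineArrangement.exists_generic
    (fun i => slope ε q (e.symm i)) (fun i => intercept ε (e.symm i))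
  obtain ⟨C, hC⟩ := hA.exists_generates
  have hs : ∀ x, A.slope (e x) = slope ε q x := by
    intro x
    rw [hAs]
    exact congrArg (slope ε q) (e.symm_apply_apply x)
  refine ⟨C, ⟨A, ?_, hA, hC⟩, ?_, ?_⟩
  · have h1 : Set.range A.slope = Set.range (slope ε q : Idx m h → ℝ) := by
      rw [hAs]
      exact e.symm.surjective.range_comp (slope ε q)
    rw [LineArrangement.numSlopes, h1]
    exact card_slopes_le ε hm
  · have h1 := two_mul_lost_le hC hh e hε hε' q hs (by
      intro x y z hxy hxz hlt
      apply hAt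
      · simpa using hxy
      · simpa using hxz
      · simpa [time] using hlt)
    have h2 : ((m * (m - 1) : ℕ) : ℝ) = (m : ℝ) * (m - 1) := by
      rcases m with _ | m
      · simp
      · push_cast
        simp
    have h3 : ((2 * C.lost + 2 * (m * h) + 2 * (h * h) : ℕ) : ℝ) ≤
        ((m * (m - 1) + 4 * (m * (h * h)) + 2 * (h * (h * h)) : ℕ) : ℝ) := by exact_mod_cast h1
    rw [Nat.cast_add (m * (m - 1) + _), Nat.cast_add (m * (m - 1)), h2] at h3
    push_cast at h3
    nlinarith
  · have h1 := hC.two_mul_len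
    have h2 := Finset.card_filter_add_card_filter_not
      (s := (univ : Finset (Fin (m + 2 * h) × Fin (m + 2 * h))))
      (fun p => A.slope p.1 = A.slope p.2)
    have h3 : (univ.filter fun p : Fin (m + 2 * h) × Fin (m + 2 * h) =>
        A.slope p.1 = A.slope p.2).card ≤ m * q + 2 * h * h := by
      rw [← Finset.card_map (e.prodCongr e).symm.toEmbedding]
      refine le_trans (Finset.card_le_card ?_) (card_parallel_le hε hε' hq)
      intro p hp
      rw [Finset.mem_map_equiv, mem_filter] at hp
      rw [mem_filter]
      refine ⟨mem_univ _, ?_⟩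
      have := hp.2
      simpa [hs] using this
    have h4 : 2 * C.len = (univ.filter fun p : Fin (m + 2 * h) × Fin (m + 2 * h) =>
        ¬ A.slope p.1 = A.slope p.2).card := by
      convert h1
    simp only [Finset.card_univ, Fintype.card_prod, Fintype.card_fin] at h2
    have h5 : (m + 2 * h) * (m + 2 * h) ≤ 2 * C.len + (m * q + 2 * h * h) := by omega
    have h6 : ((((m + 2 * h) * (m + 2 * h) : ℕ)) : ℝ) ≤
        ((2 * C.len + (m * q + 2 * h * h) : ℕ) : ℝ) := by exact_mod_cast h5
    push_cast at h6
    nlinarith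

end Sweep

/-! ### Asymptotics of the maximum -/

/-- An upper bound for the maximum, from an inequality between numbers of lines and packets. -/
theorem rgmsnMaxCapacity_le {n s : ℕ} (hn : 0 < n) (hs : 3 ≤ s) {X : ℝ} (hX : X ≤ 1)
    (hbound : ∀ (a c m : ℕ) (L : ℝ), 1 ≤ a → 1 ≤ c → m + (a + c) = n → 0 ≤ L →
      L ≤ m * (a + c) + a * c + (1 - 1 / ((s : ℝ) - 2)) * m ^ 2 / 2 →
      n * L * X ≤ (m : ℝ) * (m - 3) / 2 + m * ((a + c) * (a + c - 1)) / 2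
        + a * c * (a + c - 2) / 2) :
    rgmsnMaxCapacity n s ≤ 1 - X := by
  obtain ⟨C, ⟨A, hAs, hA, hC⟩, hmax⟩ := (isGreatest_rgmsnMaxCapacity n s (by omega)).1
  rw [hmax]
  rcases Nat.eq_zero_or_pos C.len with h0 | hL
  · rw [C.capacity_eq_zero_of_len h0]
    linarith
  · rw [C.capacity_eq_one_sub hn hL]
    obtain ⟨a, c, m, ha, hc, hm, h1, h2⟩ := hC.exists_bounds hA hAs hs hL
    have h3 := hbound a c m C.len ha hc hm (by positivity) h1
    have h4 : X ≤ (C.lost : ℝ) / ((n : ℝ) * (C.len : ℝ)) := by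
      rw [le_div_iff₀ (by positivity)]
      linarith
    linarith

/-- A lower bound for the maximum, from an inequality about the parameters of the construction. -/
theorem le_rgmsnMaxCapacity {n m h q r : ℕ} (hn : n = m + 2 * h) (hh : 0 < h) (hq : 0 < q)
    (hm : m ≤ q * r) {X : ℝ} (hX : 0 ≤ X) (hpos : 0 < (n : ℝ) ^ 2 - m * q - 2 * h ^ 2)
    (hbound : (m : ℝ) * (m - 1) / 2 + m * (h * (2 * h - 1)) + h ^ 2 * (h - 1) ≤
      n * (((n : ℝ) ^ 2 - m * q - 2 * h ^ 2) / 2) * X) :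
    1 - X ≤ rgmsnMaxCapacity n (r + 2) := by
  subst hn
  obtain ⟨C, hC, h1, h2⟩ := Sweep.exists_network m h q r hh hq hm
  refine le_trans ?_ ((isGreatest_rgmsnMaxCapacity (m + 2 * h) (r + 2) (by omega)).2 ⟨C, hC, rfl⟩)
  push_cast at hpos hbound
  have hL : 0 < C.len := by
    have : (0 : ℝ) < C.len := by linarith
    exact_mod_cast this
  rw [C.capacity_eq_one_sub (by omega) hL]
  have h3 : (C.lost : ℝ) / (((m + 2 * h : ℕ) : ℝ) * (C.len : ℝ)) ≤ X := by
    have hL' : (0 : ℝ) < C.len := by exact_mod_cast hL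
    have hn' : (0 : ℝ) < ((m + 2 * h : ℕ) : ℝ) := by exact_mod_cast (by omega : 0 < m + 2 * h)
    rw [div_le_iff₀ (by positivity)]
    push_cast at hn' ⊢
    have h4 : (((m : ℝ) + 2 * h) ^ 2 - m * q - 2 * h ^ 2) / 2 ≤ C.len := by linarith
    have h5 := mul_le_mul_of_nonneg_left h4 (mul_nonneg hn'.le hX)
    nlinarith
  linarith

/-- With at least six extreme lines their own failed deliveries suffice for the bound. With fewer,
the deficit is linear in `n`. -/
theorem max_le_of_four_le {n s : ℕ} (hs : 4 ≤ s) (hn : 40 ≤ n) :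
    rgmsnMaxCapacity n s ≤
      1 - (((s : ℝ) - 2) / ((s : ℝ) - 3) / n - 96 / (n : ℝ) ^ 2) := by
  have hs' : (4 : ℝ) ≤ s := by exact_mod_cast hs
  have hn' : (40 : ℝ) ≤ n := by exact_mod_cast hn
  set ρ : ℝ := ((s : ℝ) - 2) / ((s : ℝ) - 3) with hρ
  have hρ2 : ρ ≤ 2 := by
    rw [hρ, div_le_iff₀ (by linarith)]
    linarith
  have hρ0 : 0 ≤ ρ := div_nonneg (by linarith) (by linarith)
  have hρ1 : ρ * (1 - 1 / ((s : ℝ) - 2)) = 1 := by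
    have h1 : (s : ℝ) - 2 ≠ 0 := by linarith
    have h2 : (s : ℝ) - 3 ≠ 0 := by linarith
    rw [hρ]
    field_simp
    ring
  apply rgmsnMaxCapacity_le (by omega) (by omega)
  · have h1 : ρ / n ≤ 1 := by
      rw [div_le_one (by linarith)]
      linarith
    have h2 : 0 ≤ 96 / (n : ℝ) ^ 2 := by positivity
    linarith
  intro a c m L ha hc hm hL0 hL
  have hX : (n : ℝ) * L * (ρ / n - 96 / (n : ℝ) ^ 2) = ρ * L - 96 * (L / n) := by
    field_simp
  rw [hX]
  have hk2 : (2 : ℝ) ≤ (a : ℝ) + c := by exact_mod_cast (by omega : 2 ≤ a + c)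
  have hmn : (m : ℝ) + (a + c) = n := by exact_mod_cast hm
  have hP : (a : ℝ) * c ≤ ((a : ℝ) + c) ^ 2 / 4 := by nlinarith [sq_nonneg ((a : ℝ) - c)]
  have hP0 : (0 : ℝ) ≤ (a : ℝ) * c := by positivity
  have hm0 : (0 : ℝ) ≤ m := by positivity
  have hkk : 6 ≤ a + c ∨ a + c ≤ 5 := by omega
  have hLn : 0 ≤ L / n := by positivity
  have hρL : ρ * L ≤ 2 * (m * ((a : ℝ) + c) + a * c) + m ^ 2 / 2 := by
    have h1 := mul_le_mul_of_nonneg_left hL hρ0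
    have h2 : ρ * (m * ((a : ℝ) + c) + a * c + (1 - 1 / ((s : ℝ) - 2)) * m ^ 2 / 2) =
        ρ * (m * ((a : ℝ) + c) + a * c) + (ρ * (1 - 1 / ((s : ℝ) - 2))) * m ^ 2 / 2 := by ring
    rw [h2, hρ1] at h1
    have h3 : ρ * (m * ((a : ℝ) + c) + a * c) ≤ 2 * (m * ((a : ℝ) + c) + a * c) :=
      mul_le_mul_of_nonneg_right hρ2 (by positivity)
    linarith
  set k : ℝ := (a : ℝ) + c with hk
  set P : ℝ := (a : ℝ) * c with hPdef
  rcases hkk with h6 | h5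
  · have hk6 : (6 : ℝ) ≤ k := by
      rw [hk]
      exact_mod_cast h6
    have h1 : 0 ≤ m * ((k - 6) * (k + 1) + 3) := by
      apply mul_nonneg hm0
      have := mul_nonneg (sub_nonneg.2 hk6) (by linarith : 0 ≤ k + 1)
      linarith
    have h2 : 0 ≤ P * (k - 6) := mul_nonneg hP0 (sub_nonneg.2 hk6)
    linarith
  · have hk5 : k ≤ 5 := by
      rw [hk]
      exact_mod_cast h5
    have hP7 : P ≤ 7 := by nlinarith
    rcases le_or_gt ((n : ℝ) ^ 2 / 16) L with hbig | hsmall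
    · -- many packets: the second-order term pays for the linear deficit
      have h1 : (n : ℝ) / 16 ≤ L / n := by
        rw [le_div_iff₀ (by linarith)]
        linarith
      have h2 : P * (6 - k) ≤ 7 * 4 := mul_le_mul hP7 (by linarith) (by linarith) (by norm_num)
      have h3 : m * (k * (k - 1) / 2 - 2 * k) ≥ m * (-7 / 2) := by
        apply mul_le_mul_of_nonneg_left _ hm0
        linarith [sq_nonneg (k - 5 / 2)]
      linarith
    · -- few packets: the deliveries missed by the middle lines suffice
      have h1 : ρ * L ≤ 2 * ((n : ℝ) ^ 2 / 16) := mul_le_mul hρ2 hsmall.le hL0 (by norm_num)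
      have h2 : 0 ≤ m * (k * (k - 1)) / 2 := by
        have : 0 ≤ k * (k - 1) := mul_nonneg (by linarith) (by linarith)
        positivity
      have h3 : 0 ≤ P * (k - 2) / 2 := by
        have : 0 ≤ k - 2 := by linarith
        positivity
      have h4 : (n : ℝ) - 5 ≤ m := by linarith
      have h5 : ((n : ℝ) - 5) * ((n : ℝ) - 8) ≤ m * (m - 3) := by
        apply mul_le_mul h4 (by linarith) (by linarith) hm0
      have h6 : (n : ℝ) * 40 ≤ n * n := mul_le_mul_of_nonneg_left hn' (by linarith)
      linarith

theorem le_max_of_four_le {n s : ℕ} (hs : 4 ≤ s) (hn : 40 ≤ n) :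
    1 - (((s : ℝ) - 2) / ((s : ℝ) - 3) / n - 1 / (n : ℝ) ^ 2) ≤ rgmsnMaxCapacity n s := by
  obtain ⟨r, rfl⟩ : ∃ r, s = r + 2 := ⟨s - 2, by omega⟩
  obtain ⟨m, rfl⟩ : ∃ m, n = m + 2 * 1 := ⟨n - 2, by omega⟩
  have hr : (2 : ℝ) ≤ r := by exact_mod_cast (by omega : 2 ≤ r)
  have hm : (38 : ℝ) ≤ m := by exact_mod_cast (by omega : 38 ≤ m)
  have hq : m ≤ (m / r + 1) * r := by
    rw [mul_comm]
    exact (Nat.lt_mul_div_succ m (by omega)).le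
  have hdiv : ((m / r : ℕ) : ℝ) ≤ (m : ℝ) / r := Nat.cast_div_le
  have e2 : ((r + 2 : ℕ) : ℝ) - 2 = r := by push_cast; ring
  have e3 : ((r + 2 : ℕ) : ℝ) - 3 = r - 1 := by push_cast; ring
  have en : ((m + 2 * 1 : ℕ) : ℝ) = m + 2 := by push_cast; ring
  rw [e2, e3, en]
  set w : ℝ := (m : ℝ) / r with hw
  have hwr : w * r = m := by
    rw [hw]
    field_simp
  have hw0 : 0 ≤ w := by positivity
  have hw2 : w ≤ m / 2 := by
    rw [hw]
    exact div_le_div_of_nonneg_left (by linarith) (by norm_num) hr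
  have hmw := mul_le_mul_of_nonneg_left hdiv (by linarith : (0 : ℝ) ≤ m)
  have hΛ : ((m : ℝ) + 2) ^ 2 - m * (w + 1) - 2 ≤
      ((m : ℝ) + 2) ^ 2 - m * ((m / r : ℕ) + 1) - 2 := by linarith
  have hΛ0 : 0 < ((m : ℝ) + 2) ^ 2 - m * (w + 1) - 2 := by nlinarith
  have hρ : 1 ≤ (r : ℝ) / (r - 1) := by
    rw [le_div_iff₀ (by linarith)]
    linarith
  have hX : 1 / ((m : ℝ) + 2) ≤ 1 := by
    rw [div_le_one (by linarith)]
    linarith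
  have hfac : (r : ℝ) / (r - 1) / (m + 2) - 1 / ((m : ℝ) + 2) ^ 2 =
      ((r : ℝ) / (r - 1) - 1 / (m + 2)) / (m + 2) := by
    have : (m : ℝ) + 2 ≠ 0 := by positivity
    have : (r : ℝ) - 1 ≠ 0 := by linarith
    field_simp
  rw [hfac]
  apply le_rgmsnMaxCapacity (m := m) (h := 1) (q := m / r + 1) (r := r) rfl one_pos
    (Nat.succ_pos _) hq
  · exact div_nonneg (by linarith) (by linarith)
  · rw [en]
    push_cast
    linarith
  · rw [en]
    push_cast
    have h1 : ((m : ℝ) + 2) * ((((m : ℝ) + 2) ^ 2 - m * (((m / r : ℕ) : ℝ) + 1) - 2 * 1 ^ 2) / 2) *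
        (((r : ℝ) / (r - 1) - 1 / (m + 2)) / (m + 2)) =
        (((m : ℝ) + 2) ^ 2 - m * (((m / r : ℕ) : ℝ) + 1) - 2) / 2 *
          ((r : ℝ) / (r - 1) - 1 / (m + 2)) := by
      have : (m : ℝ) + 2 ≠ 0 := by positivity
      have : (r : ℝ) - 1 ≠ 0 := by linarith
      field_simp
    rw [h1]
    refine le_trans ?_ (mul_le_mul_of_nonneg_right (div_le_div_of_nonneg_right hΛ (by norm_num))
      (by linarith))
    -- `ρ = r / (r - 1)` satisfies `ρ (m² - m w) = m²`
    set ρ : ℝ := (r : ℝ) / (r - 1) with hρdef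
    have hρm : ρ * (m - w) = m := by
      have : (r : ℝ) - 1 ≠ 0 := by linarith
      rw [hρdef, div_mul_eq_mul_div, div_eq_iff this]
      linarith
    have h2 : (((m : ℝ) + 2) ^ 2 - m * (w + 1) - 2) * (1 / (m + 2)) ≤ m + 2 := by
      rw [mul_one_div, div_le_iff₀ (by linarith)]
      nlinarith
    have h3 : ρ * (((m : ℝ) + 2) ^ 2 - m * (w + 1) - 2) = m * m + ρ * (3 * m + 2) := by
      linear_combination (m : ℝ) * hρm
    nlinarith
/-- The gap between the two sides of the bound for three slopes, without the contribution of the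
pairs of extreme lines; here `y` stands for `k / t`. -/
theorem three_slopes_gap_at_zero {t k m y : ℝ} (ht : 16 ≤ t) (hk : 0 ≤ k) (hm : 0 ≤ m)
    (hy : y * t = k) : 0 ≤ m * ((t - k) ^ 2 / 2 + k / 8 - 3 / 2 + 10 * y) := by
  apply mul_nonneg hm
  have hy0 : 0 ≤ y := by
    by_contra h
    nlinarith
  rcases le_or_gt (t / 2) k with h | h
  · have : 1 / 2 ≤ y := by
      by_contra h'
      nlinarith
    linarith [sq_nonneg (t - k)]
  · have : 8 * 8 ≤ (t - k) * (t - k) :=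
      mul_le_mul (by linarith) (by linarith) (by norm_num) (by linarith)
    linarith

/-- The same gap when the number of pairs of extreme lines has its largest value `k² / 4`. The terms
of order `t³` have cancelled in this form, and the term in `y` outweighs the negative ones. -/
theorem three_slopes_gap_at_max {t k m y : ℝ} (ht : 16 ≤ t) (hk : 2 ≤ k) (hm : 0 ≤ m)
    (hmk : m = t ^ 2 - k) (hy : y * t = k) :
    0 ≤ m * ((t - k) ^ 2 / 2 - 3 / 2 + 10 * y) + k * (t - k) ^ 2 / 8 - 3 * k ^ 2 / 32
      + 10 * y * k / 4 := by
  have htpos : 0 < t := by linarith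
  have hy0 : 0 ≤ y := by
    by_contra h
    nlinarith
  have hyk : 0 ≤ 10 * y * k / 4 := by positivity
  rcases le_or_gt (t / 2) k with h | h
  · have h3 : 1 / 2 ≤ y := by
      by_contra h'
      nlinarith
    rcases le_or_gt k (2 * t) with h2 | h2
    · have h4 : t ^ 2 / 2 ≤ m := by nlinarith
      have h5 : t ^ 2 / 2 * (5 * y) ≤ m * ((t - k) ^ 2 / 2 - 3 / 2 + 10 * y) := by
        apply mul_le_mul h4 _ (by positivity) hm
        linarith [sq_nonneg (t - k)]
      have h6 : t ^ 2 / 2 * (5 * y) = 5 / 2 * (t * k) := by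
        rw [← hy]
        ring
      have h7 : k * k ≤ k * (2 * t) := mul_le_mul_of_nonneg_left h2 (by linarith)
      have h8 : 0 ≤ k * (t - k) ^ 2 / 8 := by positivity
      have h9 : 0 ≤ t * k := by positivity
      linarith
    · have h4 : k / 2 * (k / 2) ≤ (k - t) * (k - t) :=
        mul_le_mul (by linarith) (by linarith) (by linarith) (by linarith)
      have h5 : 0 ≤ m * ((t - k) ^ 2 / 2 - 3 / 2 + 10 * y) := by
        apply mul_nonneg hm
        linarith [sq_nonneg (t - k)]
      have h6 : k * (k / 2 * (k / 2)) ≤ k * ((k - t) * (k - t)) :=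
        mul_le_mul_of_nonneg_left h4 (by linarith)
      have h7 : 3 * k ^ 2 ≤ k * k ^ 2 := mul_le_mul_of_nonneg_right (by linarith) (by positivity)
      linarith
  · have h3 : t / 2 * (t / 2) ≤ (t - k) * (t - k) :=
      mul_le_mul (by linarith) (by linarith) (by linarith) (by linarith)
    have h4 : 16 * 16 ≤ t * t := mul_le_mul ht ht (by norm_num) htpos.le
    have h5 : 0 ≤ m * ((t - k) ^ 2 / 2 - 3 / 2 + 10 * y) := by
      apply mul_nonneg hm
      linarith
    have h6 : k * (t / 2 * (t / 2)) ≤ k * ((t - k) * (t - k)) :=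
      mul_le_mul_of_nonneg_left h3 (by linarith)
    have h7 : k * (3 * k) ≤ k * (t * t) := by
      apply mul_le_mul_of_nonneg_left _ (by linarith)
      have : 2 * t ≤ t * t := mul_le_mul_of_nonneg_right (by linarith) htpos.le
      linarith
    linarith

theorem max_le_three {n : ℕ} {t : ℝ} (ht : t ^ 2 = n) (ht0 : 16 ≤ t) :
    rgmsnMaxCapacity n 3 ≤ 1 - (1 / t - 9 / 8 / t ^ 2 - 10 / t ^ 3) := by
  have htpos : (0 : ℝ) < t := by linarith
  have hnpos : 0 < n := by
    have : (0 : ℝ) < n := by rw [← ht]; positivity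
    exact_mod_cast this
  apply rgmsnMaxCapacity_le hnpos le_rfl
  · have h1 : 1 / t ≤ 1 := by
      rw [div_le_one htpos]
      linarith
    have h2 : 0 ≤ 9 / 8 / t ^ 2 := by positivity
    have h3 : 0 ≤ 10 / t ^ 3 := by positivity
    linarith
  intro a c m L ha hc hm hL0 hL
  have hX : (n : ℝ) * L * (1 / t - 9 / 8 / t ^ 2 - 10 / t ^ 3) = L * (t - 9 / 8 - 10 / t) := by
    rw [← ht]
    field_simp
  rw [hX]
  have hmn : (m : ℝ) + (a + c) = t ^ 2 := by
    rw [ht]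
    exact_mod_cast hm
  have hP : (a : ℝ) * c ≤ ((a : ℝ) + c) ^ 2 / 4 := by nlinarith [sq_nonneg ((a : ℝ) - c)]
  have hP0 : (0 : ℝ) ≤ (a : ℝ) * c := by positivity
  have hm0 : (0 : ℝ) ≤ m := by positivity
  have hk2 : (2 : ℝ) ≤ (a : ℝ) + c := by exact_mod_cast (by omega : 2 ≤ a + c)
  have hL' : L ≤ m * ((a : ℝ) + c) + a * c := by
    norm_num at hL
    linarith
  set k : ℝ := (a : ℝ) + c with hk
  set P : ℝ := (a : ℝ) * c with hPdef
  have h10 : 10 / t ≤ 1 := by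
    rw [div_le_one htpos]
    linarith
  have hXpos : 0 ≤ t - 9 / 8 - 10 / t := by linarith
  refine (mul_le_mul_of_nonneg_right hL' hXpos).trans ?_
  set y : ℝ := k / t with hy
  have hyt : y * t = k := by
    rw [hy]
    field_simp
  have hy0 : 0 ≤ y := by positivity
  have hky : k * (10 / t) = 10 * y := by
    rw [hy]
    ring
  have hmk : (m : ℝ) = t ^ 2 - k := by linarith
  -- the difference is affine in `P`, so it suffices to bound it at `P = 0` and at `P = k² / 4`
  have hF0 := three_slopes_gap_at_zero ht0 (by linarith) hm0 hyt
  have hF1 := three_slopes_gap_at_max ht0 hk2 hm0 hmk hyt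
  have hid0 : m * (m - 3) / 2 + m * (k * (k - 1)) / 2 - m * k * (t - 9 / 8 - 10 / t) =
      m * ((t - k) ^ 2 / 2 + k / 8 - 3 / 2 + 10 * y) := by
    have : m * k * (t - 9 / 8 - 10 / t) = m * (k * t - k * (9 / 8) - k * (10 / t)) := by ring
    rw [this, hky, hmk]
    ring
  have hid1 : m * (m - 3) / 2 + m * (k * (k - 1)) / 2 + k ^ 2 / 4 * (k - 2) / 2
      - (m * k + k ^ 2 / 4) * (t - 9 / 8 - 10 / t) =
      m * ((t - k) ^ 2 / 2 - 3 / 2 + 10 * y) + k * (t - k) ^ 2 / 8 - 3 * k ^ 2 / 32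
      + 10 * y * k / 4 := by
    have : (m * k + k ^ 2 / 4) * (t - 9 / 8 - 10 / t) =
        (m + k / 4) * (k * t - k * (9 / 8) - k * (10 / t)) := by ring
    rw [this, hky, hmk]
    ring
  rw [← hid0] at hF0
  rw [← hid1] at hF1
  have hkpos : 0 < k ^ 2 / 4 := by positivity
  set Z : ℝ := t - 9 / 8 - 10 / t with hZ
  -- `k² / 4` times the gap at `P` is the combination of the gaps at the ends with weights
  -- `k² / 4 - P` and `P`
  have hc := add_nonneg (mul_nonneg (sub_nonneg.2 hP) hF0) (mul_nonneg hP0 hF1)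
  have hfin : 0 ≤ k ^ 2 / 4 * (m * (m - 3) / 2 + m * (k * (k - 1)) / 2 + P * (k - 2) / 2
      - (m * k + P) * Z) := by
    refine le_trans hc (le_of_eq ?_)
    ring
  have := nonneg_of_mul_nonneg_right hfin hkpos
  linarith

theorem le_max_three {n : ℕ} {t : ℝ} (ht : t ^ 2 = n) (ht0 : 30 ≤ t) :
    1 - (1 / t - 9 / 8 / t ^ 2 - 1 / 100 / t ^ 3) ≤ rgmsnMaxCapacity n 3 := by
  have htpos : (0 : ℝ) < t := by linarith
  -- the number `2 * h` of extreme lines is the even integer closest to `t`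
  obtain ⟨h, hlo, hhi⟩ : ∃ h : ℕ, t - 1 ≤ 2 * (h : ℝ) ∧ 2 * (h : ℝ) ≤ t + 1 := by
    refine ⟨⌊t / 2 + 1 / 2⌋₊, ?_, ?_⟩
    · have := Nat.lt_floor_add_one (t / 2 + 1 / 2)
      linarith
    · have := Nat.floor_le (by linarith : 0 ≤ t / 2 + 1 / 2)
      linarith
  have hh : 0 < h := by
    have : (0 : ℝ) < h := by linarith
    exact_mod_cast this
  have hlt : 2 * h < n := by
    have : 2 * (h : ℝ) < n := by
      rw [← ht]
      nlinarith
    exact_mod_cast this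
  obtain ⟨m, hm⟩ : ∃ m, n = m + 2 * h := ⟨n - 2 * h, by omega⟩
  have hmn : (m : ℝ) = t ^ 2 - 2 * h := by
    rw [ht, hm]
    push_cast
    ring
  have hm0 : (0 : ℝ) ≤ m := by positivity
  have h2 : 1 / 100 / t ≤ 1 := by
    rw [div_le_one htpos]
    linarith
  have hfac : 1 / t - 9 / 8 / t ^ 2 - 1 / 100 / t ^ 3 = (t - 9 / 8 - 1 / 100 / t) / t ^ 2 := by
    field_simp
  rw [hfac]
  set k : ℝ := 2 * (h : ℝ) with hk
  have hhk : (h : ℝ) = k / 2 := by rw [hk]; ring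
  apply le_rgmsnMaxCapacity (m := m) (h := h) (q := m) (r := 1) hm hh (by omega) (by omega)
  · exact div_nonneg (by linarith) (by positivity)
  · rw [← ht, hmn, hhk]
    have : (t ^ 2) ^ 2 - (t ^ 2 - k) * (t ^ 2 - k) - 2 * (k / 2) ^ 2 =
        k * (2 * t ^ 2 - 3 / 2 * k) := by ring
    rw [this]
    apply mul_pos (by linarith)
    nlinarith
  · have h3 : (n : ℝ) * (((n : ℝ) ^ 2 - m * m - 2 * h ^ 2) / 2) *
        ((t - 9 / 8 - 1 / 100 / t) / t ^ 2) =
        (m + k / 4) * (k * t - k * (9 / 8) - k * (1 / 100 / t)) := by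
      rw [← ht, hmn, hhk]
      field_simp
      ring
    rw [h3]
    set y : ℝ := k / t with hy
    have hky : k * (1 / 100 / t) = y / 100 := by
      rw [hy]
      ring
    have hy2 : y ≤ 2 := by
      rw [hy, div_le_iff₀ htpos]
      linarith
    have hd : (t - k) ^ 2 ≤ 1 := by
      rw [sq_le_one_iff_abs_le_one, abs_le]
      constructor <;> linarith
    have hmt : (m : ℝ) ≤ t ^ 2 := by linarith
    have h4 : m * ((t - k) ^ 2 / 2 - 1 / 2 + y / 100) ≤ t ^ 2 / 50 := by
      have : (t - k) ^ 2 / 2 - 1 / 2 + y / 100 ≤ 1 / 50 := by linarith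
      calc (m : ℝ) * ((t - k) ^ 2 / 2 - 1 / 2 + y / 100) ≤ m * (1 / 50) :=
            mul_le_mul_of_nonneg_left this hm0
        _ ≤ t ^ 2 / 50 := by linarith
    have h5 : k * (t - k) ^ 2 / 8 ≤ t / 4 := by nlinarith
    have h6 : y / 100 * k / 4 ≤ t / 100 := by
      have : y * k ≤ 2 * (2 * t) := mul_le_mul hy2 (by linarith) (by linarith) (by norm_num)
      linarith
    have h7 : 3 * (t - 1) ^ 2 / 32 ≤ 3 * k ^ 2 / 32 := by
      have : (t - 1) ^ 2 ≤ k ^ 2 := pow_le_pow_left₀ (by linarith) hlo 2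
      linarith
    have h8 : t ^ 2 / 50 + t / 4 + t / 100 ≤ 3 * (t - 1) ^ 2 / 32 := by nlinarith
    have hid : (m : ℝ) * (m - 1) / 2 + m * (h * (k - 1)) + h ^ 2 * (h - 1)
        - (m + k / 4) * (k * t - k * (9 / 8) - k * (1 / 100 / t)) =
        m * ((t - k) ^ 2 / 2 - 1 / 2 + y / 100) + k * (t - k) ^ 2 / 8 - 3 * k ^ 2 / 32
        + y / 100 * k / 4 := by
      rw [hky, hmn, hhk]
      ring
    linarith

theorem mainTheorem2 (s : ℕ) (hs : 3 ≤ s) :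
    (∀ n : ℕ, 2 ≤ n → IsGreatest (rgmsnCapacities n s) (rgmsnMaxCapacity n s)) ∧
    (4 ≤ s → ∃ c₁ : ℝ, 0 < c₁ ∧ ∃ c₂ : ℝ, 0 < c₂ ∧ ∀ᶠ n : ℕ in Filter.atTop,
      c₁ * (n : ℝ) ^ (-2 : ℝ) ≤
        rgmsnMaxCapacity n s - (1 - ((s : ℝ) - 2) / ((s : ℝ) - 3) * (n : ℝ) ^ (-1 : ℝ)) ∧
      rgmsnMaxCapacity n s - (1 - ((s : ℝ) - 2) / ((s : ℝ) - 3) * (n : ℝ) ^ (-1 : ℝ)) ≤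
        c₂ * (n : ℝ) ^ (-2 : ℝ)) ∧
    (s = 3 → ∃ c₁ : ℝ, 0 < c₁ ∧ ∃ c₂ : ℝ, 0 < c₂ ∧ ∀ᶠ n : ℕ in Filter.atTop,
      c₁ * (n : ℝ) ^ (-(3 / 2) : ℝ) ≤
        rgmsnMaxCapacity n s -
          (1 - (n : ℝ) ^ (-(1 / 2) : ℝ) + 9 / 8 * (n : ℝ) ^ (-1 : ℝ)) ∧
      rgmsnMaxCapacity n s -
          (1 - (n : ℝ) ^ (-(1 / 2) : ℝ) + 9 / 8 * (n : ℝ) ^ (-1 : ℝ)) ≤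
        c₂ * (n : ℝ) ^ (-(3 / 2) : ℝ)) := by
  refine ⟨fun n _ => isGreatest_rgmsnMaxCapacity n s (by omega), fun hs4 => ?_, fun hs3 => ?_⟩
  · refine ⟨1, one_pos, 96, by norm_num, ?_⟩
    filter_upwards [Filter.eventually_ge_atTop 40] with n hn
    have h1 := max_le_of_four_le hs4 hn
    have h2 := le_max_of_four_le hs4 hn
    have e1 : (n : ℝ) ^ (-1 : ℝ) = (n : ℝ)⁻¹ := Real.rpow_neg_one _
    have e2 : (n : ℝ) ^ (-2 : ℝ) = ((n : ℝ) ^ 2)⁻¹ := by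
      rw [Real.rpow_neg (by positivity)]
      norm_cast
    rw [e1, e2, ← div_eq_mul_inv, ← div_eq_mul_inv, ← div_eq_mul_inv]
    constructor <;> linarith
  · subst hs3
    refine ⟨1 / 100, by norm_num, 10, by norm_num, ?_⟩
    filter_upwards [Filter.eventually_ge_atTop 900] with n hn
    have hn' : (900 : ℝ) ≤ n := by exact_mod_cast hn
    set t : ℝ := Real.sqrt n with htdef
    have ht : t ^ 2 = n := Real.sq_sqrt (by linarith)
    have ht0 : 30 ≤ t := Real.le_sqrt_of_sq_le (by linarith)
    have htpos : 0 ≤ t := by linarith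
    have h1 := max_le_three ht (by linarith)
    have h2 := le_max_three ht ht0
    have e0 : ∀ x : ℝ, (n : ℝ) ^ x = t ^ (2 * x) := by
      intro x
      rw [← ht, ← Real.rpow_natCast, ← Real.rpow_mul htpos]
      norm_num
    have e1 : (n : ℝ) ^ (-1 : ℝ) = (t ^ 2)⁻¹ := by rw [ht]; exact Real.rpow_neg_one _
    have e2 : (n : ℝ) ^ (-(1 / 2) : ℝ) = t⁻¹ := by
      rw [e0, ← Real.rpow_neg_one]
      norm_num
    have e3 : (n : ℝ) ^ (-(3 / 2) : ℝ) = (t ^ 3)⁻¹ := by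
      rw [e0, show (2 : ℝ) * (-(3 / 2)) = -3 by norm_num, Real.rpow_neg htpos]
      norm_cast
    rw [e1, e2, e3, ← div_eq_mul_inv, ← div_eq_mul_inv, ← div_eq_mul_inv, ← one_div]
    constructor <;> linarith
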